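/- **Setting.** Let $p:\mathbb R^n\to\mathbb R\cup\{+\infty\}$ and $q:\mathbb R^m\to\mathbb R\cup\{+\infty\}$ be proper closed convex functions with compact domains, let $\bar h:\mathbb R^n\times\mathbb R^m\to\mathbb R$, let $\sigma_x,\sigma_y,L,\bar\epsilon>0$, and consider $$\bar H^*=\min_x\max_y\{\bar H(x,y):=\bar h(x,y)+p(x)-q(y)\}.$$ Let $U\supseteq\mathrm{dom}\,p$ and $V\supseteq\mathrm{dom}\,q$ be convex sets such that all points at which the algorithm below evaluates $\nabla\bar h$ lie in $U\times V$ (which is automatic for $U=\mathbb R^n$, $V=\mathbb R^m$). Assume that $\bar h(\cdot,y)$ is $\sigma_x$-strongly convex on $U$ for every $y\in V$, that $\bar h(x,\cdot)$ is $\sigma_y$-strongly concave on $V$ for every $x\in U$, and that $\bar h$ is differentiable at the points of $U\times V$ with $\|\nabla\bar h(u)-\nabla\bar h(v)\|\le L\|u-v\|$ for $u,v\in U\times V$. **Notation.** $\mathrm{prox}_{\phi}(v)=\arg\min_{x}\{\frac12\|x-v\|^2+\phi(x)\}$; $\hat h(x,y)=\bar h(x,y)-\frac{\sigma_x}2\|x\|^2+\frac{\sigma_y}2\|y\|^2$;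 $\bar\alpha=\min\{1,\sqrt{8\sigma_y/\sigma_x}\}$, $\eta_z=\sigma_x/2$, $\eta_y=\min\{1/(2\sigma_y),4/(\bar\alpha\sigma_x)\}$, $\beta_t=2/(t+3)$, $\zeta=(2\sqrt5(1+8L/\sigma_x))^{-1}$, $\gamma=8/\sigma_x$, $\bar\zeta=\min\{\sigma_x,\sigma_y\}/L^2$, and $\lceil r\rceil_+=\max\{\lceil r\rceil,0\}$. **Algorithm.** Let $z^0=z^0_f\in-\sigma_x\,\mathrm{dom}\,p$ and $y^0=y^0_f\in\mathrm{dom}\,q$. For $k=0,1,2,\dots$ do the following. 1. Put $(z_g,y_g)=\bar\alpha(z^k,y^k)+(1-\bar\alpha)(z^k_f,y^k_f)$, $(x^{-1},y^{-1})=(-\sigma_x^{-1}z_g,y_g)$, $a_x(x,y)=\nabla_x\hat h(x,y)+\frac{\sigma_x}2(x-\sigma_x^{-1}z_g)$ and $a_y(x,y)=-\nabla_y\hat h(x,y)+\sigma_yy+\frac{\sigma_x}8(y-y_g)$. Put $v_x=x^{-1}-\zeta\gamma a_x(x^{-1},y^{-1})$, $\xi^0=\mathrm{prox}_{\zeta\gamma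 p}(v_x)$ and $b_x^0=(v_x-\xi^0)/(\zeta\gamma)$; and $v_y=y^{-1}-\zeta\gamma a_y(x^{-1},y^{-1})$, $\upsilon^0=\mathrm{prox}_{\zeta\gamma q}(v_y)$ and $b_y^0=(v_y-\upsilon^0)/(\zeta\gamma)$. Set $t=0$. 2. While $\gamma\|a_x(\xi^t,\upsilon^t)+b_x^t\|^2+\gamma\|a_y(\xi^t,\upsilon^t)+b_y^t\|^2>\gamma^{-1}\|\xi^t-x^{-1}\|^2+\gamma^{-1}\|\upsilon^t-y^{-1}\|^2$, put $\xi^{t+1/2}=\xi^t+\beta_t(\xi^0-\xi^t)-\zeta\gamma(a_x(\xi^t,\upsilon^t)+b^t_x)$, $\upsilon^{t+1/2}=\upsilon^t+\beta_t(\upsilon^0-\upsilon^t)-\zeta\gamma(a_y(\xi^t,\upsilon^t)+b^t_y)$, $v_x=\xi^t+\beta_t(\xi^0-\xi^t)-\zeta\gamma a_x(\xi^{t+1/2},\upsilon^{t+1/2})$, $\xi^{t+1}=\mathrm{prox}_{\zeta\gamma p}(v_x)$, $b_x^{t+1}=(v_x-\xi^{t+1})/(\zeta\gamma)$, $v_y=\upsilon^t+\beta_t(\upsilon^0-\upsilon^t)-\zeta\gamma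 a_y(\xi^{t+1/2},\upsilon^{t+1/2})$, $\upsilon^{t+1}=\mathrm{prox}_{\zeta\gamma q}(v_y)$, $b_y^{t+1}=(v_y-\upsilon^{t+1})/(\zeta\gamma)$, and $t\leftarrow t+1$. 3. Put $(x_f^{k+1},y_f^{k+1})=(\xi^t,\upsilon^t)$, $z_f^{k+1}=\nabla_x\hat h(x_f^{k+1},y_f^{k+1})+b_x^t$, $w_f^{k+1}=-\nabla_y\hat h(x_f^{k+1},y_f^{k+1})+b_y^t$, $z^{k+1}=z^k+\eta_z\sigma_x^{-1}(z_f^{k+1}-z^k)-\eta_z(x_f^{k+1}+\sigma_x^{-1}z_f^{k+1})$, $y^{k+1}=y^k+\eta_y\sigma_y(y_f^{k+1}-y^k)-\eta_y(w_f^{k+1}+\sigma_yy_f^{k+1})$, $x^{k+1}=-\sigma_x^{-1}z^{k+1}$. 4. Put $\tilde x^{k+1}=\mathrm{prox}_{\bar\zeta p}(x^{k+1}-\bar\zeta\nabla_x\bar h(x^{k+1},y^{k+1}))$ and $\tilde y^{k+1}=\mathrm{prox}_{\bar\zeta q}(y^{k+1}+\bar\zeta\nabla_y\bar h(x^{k+1},y^{k+1}))$.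 Stop with the output $(\tilde x^{k+1},\tilde y^{k+1})$ if $$\|\bar\zeta^{-1}(x^{k+1}-\tilde x^{k+1},\tilde y^{k+1}-y^{k+1})-(\nabla\bar h(x^{k+1},y^{k+1})-\nabla\bar h(\tilde x^{k+1},\tilde y^{k+1}))\|\le\bar\epsilon .$$ Evaluations of $\nabla\bar h$, of $\mathrm{prox}_{cp}$ and of $\mathrm{prox}_{cq}$ ($c>0$) are counted; a gradient computed at an iterate is reused for that iterate. **Theorem.** The problem has a unique optimal solution $(x^*,y^*)$, that is, $x^*$ minimizes $\max_y\bar H(\cdot,y)$ and $y^*$ maximizes $\bar H(x^*,\cdot)$. Put $z^*=-\sigma_xx^*$, $$\mathcal P(z,y)=\tfrac{1}{2\sigma_x}\|z\|^2+\tfrac{\sigma_y}2\|y\|^2+\sup_x\{\langle x,z\rangle-p(x)-\hat h(x,y)+q(y)\},$$ $$\vartheta_0=\eta_z^{-1}\|z^0-z^*\|^2+\eta_y^{-1}\|y^0-y^*\|^2+2\bar\alpha^{-1}(\mathcal P(z^0,y^0)-\mathcal P(z^*,y^*)),$$ $$\bar K=\left\lceil\max\Big\{\frac2{\bar\alpha},\frac{\bar\alpha\sigma_x}{4\sigma_y}\Big\}\log\frac{4\max\{\eta_z\sigma_x^{-2},\eta_y\}\vartheta_0}{(\bar\zeta^{-1}+L)^{-2}\bar\epsilon^2}\right\rceil_+\quad(\bar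 K=0\text{ if }\vartheta_0=0).$$ Then the algorithm stops after at most $\max\{1,\bar K\}$ outer iterations, and its output is an $\bar\epsilon$-primal-dual stationary point: $\mathrm{dist}(0,\partial_x\bar H(\tilde x,\tilde y))\le\bar\epsilon$ and $\mathrm{dist}(0,\partial_y\bar H(\tilde x,\tilde y))\le\bar\epsilon$. Here $\partial\phi(x)=\{s:\langle s,d\rangle\le\phi'(x;d)\ \forall d\}$ with $\phi'(x;d)=\limsup_{x'\to x,\,\phi(x')\to\phi(x),\,\tau\downarrow0}\ \inf_{d'\to d}(\phi(x'+\tau d')-\phi(x'))/\tau$ is the upper subderivative subdifferential for lower semicontinuous $\phi$, which for convex $\phi$ is the usual one, and $\partial\phi=-\partial(-\phi)$ for upper semicontinuous $\phi$. Moreover, let $D_x,D_y$ be the diameters of $\mathrm{dom}\,p,\mathrm{dom}\,q$, let $\bar H_{\rm low}=\inf\{\bar H(x,y):x\in\mathrm{dom}\,p,\ y\in\mathrm{dom}\,q\}$, and let $\bar\delta=(2+\bar\alpha^{-1})\sigma_xD_x^2+\max\{2\sigma_y,\bar\alpha\sigma_x/4\}D_y^2$. If $\bar H_{\rm low}>-\infty$,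 then the numbers of evaluations of $\nabla\bar h$, of the proximal operator of $p$, and of the proximal operator of $q$ performed by the algorithm are each at most $$\bar N=\max\left\{1,\left\lceil\max\Big\{2,\sqrt{\tfrac{\sigma_x}{2\sigma_y}}\Big\}\log\frac{4\max\{\frac1{2\sigma_x},\min\{\frac1{2\sigma_y},\frac4{\bar\alpha\sigma_x}\}\}\big(\bar\delta+2\bar\alpha^{-1}(\bar H^*-\bar H_{\rm low})\big)}{(L^2/\min\{\sigma_x,\sigma_y\}+L)^{-2}\bar\epsilon^2}\right\rceil_+\right\}\Big(\big\lceil96\sqrt2(1+8L\sigma_x^{-1})\big\rceil+2\Big)$$ (where the term $\lceil\cdot\rceil_+$ is read as $0$ if the argument of the logarithm is $0$), and $\bar N=O(\log(1/\bar\epsilon))$ as $\bar\epsilon\downarrow0$, all other data being fixed. -/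

import Mathlib

open Set Filter Topology

noncomputable section

namespace Minimax

/-! ## Convex analysis -/

/-- The Euclidean space `ℝⁿ`. -/
abbrev Vec (n : ℕ) : Type := EuclideanSpace ℝ (Fin n)

/-- The space `ℝⁿ × ℝᵐ` with its Euclidean norm. -/
abbrev Pt (n m : ℕ) : Type := WithLp 2 (Vec n × Vec m)

/-- The point `(x, y)` of `ℝⁿ × ℝᵐ`. -/
def pair {n m : ℕ} (x : Vec n) (y : Vec m) : Pt n m := WithLp.toLp 2 (x, y)

/-- The domain of an extended real valued function. -/
def dom {n : ℕ} (φ : Vec n → EReal) : Set (Vec n) := {x | φ x < ⊤}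

/-- Proper closed convex functions `ℝⁿ → ℝ ∪ {+∞}`. -/
structure ProperClosedConvex {n : ℕ} (φ : Vec n → EReal) : Prop where
  ne_bot : ∀ x, φ x ≠ ⊥
  proper : (dom φ).Nonempty
  closed : LowerSemicontinuous φ
  convex : Convex ℝ {w : Vec n × ℝ | φ w.1 ≤ (w.2 : EReal)}

/-- The proximal operator: a minimizer over `x'` of `‖x' - v‖² / 2 + φ x'`. -/
def prox {n : ℕ} (φ : Vec n → EReal) (v : Vec n) : Vec n :=
  Classical.epsilon fun x =>
    ∀ x', ((‖x - v‖ ^ 2 / 2 : ℝ) : EReal) + φ x ≤ ((‖x' - v‖ ^ 2 / 2 : ℝ) : EReal) + φ x'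

/-- The function `c φ` for a real number `c`. -/
def scale {n : ℕ} (c : ℝ) (φ : Vec n → EReal) : Vec n → EReal := fun x => (c : EReal) * φ x

/-- The upper subderivative
`φ'(x; d) = limsup_{x' →_φ x, t ↓ 0} inf_{d' → d} (φ (x' + t d') - φ x') / t`,
where `x' →_φ x` means `x' → x` and `φ x' → φ x`, and `limsup inf_{d' → d}` is the supremum over
`δ > 0` of the upper limit of the infimum over `‖d' - d‖ < δ`. -/
def upperSubderiv {n : ℕ} (φ : Vec n → EReal) (x d : Vec n) : EReal :=
  ⨆ δ : {δ : ℝ // 0 < δ},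
    limsup
      (fun w : Vec n × ℝ =>
        ⨅ d' ∈ Metric.ball d (δ : ℝ), ((w.2⁻¹ : ℝ) : EReal) * (φ (w.1 + w.2 • d') - φ w.1))
      ((𝓝 x ⊓ comap φ (𝓝 (φ x))) ×ˢ 𝓝[>] (0 : ℝ))

/-- The subdifferential of a lower semicontinuous function at a point where it is finite (and the
empty set elsewhere). -/
def subdiff {n : ℕ} (φ : Vec n → EReal) (x : Vec n) : Set (Vec n) :=
  {s | φ x ≠ ⊤ ∧ φ x ≠ ⊥ ∧ ∀ d : Vec n, ((inner ℝ s d : ℝ) : EReal) ≤ upperSubderiv φ x d}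

/-- The subdifferential of an upper semicontinuous function: `∂ φ = - ∂ (-φ)`. -/
def subdiffUpper {n : ℕ} (φ : Vec n → EReal) (x : Vec n) : Set (Vec n) :=
  {s | -s ∈ subdiff (fun x' => -φ x') x}

/-- `(x, y)` is an `ε`-primal-dual stationary point of `min_x max_y Ψ(x, y)`:
`dist(0, ∂_x Ψ(x, y)) ≤ ε` and `dist(0, ∂_y Ψ(x, y)) ≤ ε` (the distance to the empty set is `∞`). -/
def IsStationary {n m : ℕ} (Ψ : Vec n → Vec m → EReal) (ε : ℝ) (x : Vec n) (y : Vec m) : Prop :=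
  Metric.infEDist 0 (subdiff (fun x' => Ψ x' y) x) ≤ ENNReal.ofReal ε ∧
  Metric.infEDist 0 (subdiffUpper (fun y' => Ψ x y') y) ≤ ENNReal.ofReal ε

/-! ## The problem -/

/-- The data of the problem `min_x max_y h(x, y) + p(x) - q(y)`, of the constants and the
tolerance handed to the algorithm, and of its starting point. -/
structure Input (n m : ℕ) where
  h : Pt n m → ℝ
  p : Vec n → EReal
  q : Vec m → EReal
  σx : ℝ
  σy : ℝ
  L : ℝ
  ε : ℝ
  z0 : Vec n
  y0 : Vec m

variable {n m : ℕ}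

/-- `H(x, y) = h(x, y) + p(x) - q(y)`. -/
def Input.H (I : Input n m) (x : Vec n) (y : Vec m) : EReal :=
  (I.h (pair x y) : EReal) + I.p x - I.q y

/-- `H^* = min_x max_y H(x, y)`. -/
def Input.Hstar (I : Input n m) : EReal := ⨅ x, ⨆ y, I.H x y

/-- `H_low`, the infimum of `H` over `dom p × dom q`. -/
def Input.Hlow (I : Input n m) : EReal := ⨅ x ∈ dom I.p, ⨅ y ∈ dom I.q, I.H x y

/-- `(x, y)` is an optimal solution of `min_x max_y H(x, y)`. -/
def Input.IsOptimal (I : Input n m) (x : Vec n) (y : Vec m) : Prop :=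
  (∀ x', (⨆ y', I.H x y') ≤ ⨆ y', I.H x' y') ∧ ∀ y', I.H x y' ≤ I.H x y

/-- `h` is `σx`-strongly-convex-`σy`-strongly-concave on `U × V`. -/
def StronglyConvexConcaveOn (h : Pt n m → ℝ) (σx σy : ℝ) (U : Set (Vec n)) (V : Set (Vec m)) :
    Prop :=
  (∀ y ∈ V, StrongConvexOn U σx fun x => h (pair x y)) ∧
  (∀ x ∈ U, StrongConcaveOn V σy fun y => h (pair x y))

/-- The product `U × V` in `ℝⁿ × ℝᵐ`. -/
def box (U : Set (Vec n)) (V : Set (Vec m)) : Set (Pt n m) := {w | w.fst ∈ U ∧ w.snd ∈ V}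

/-- `h` is differentiable at the points of `S`, with a gradient that is `L`-Lipschitz on `S`. -/
def SmoothOn (h : Pt n m → ℝ) (L : ℝ) (S : Set (Pt n m)) : Prop :=
  (∀ w ∈ S, DifferentiableAt ℝ h w) ∧
  ∀ w ∈ S, ∀ w' ∈ S, ‖gradient h w - gradient h w'‖ ≤ L * ‖w - w'‖

/-! ## Parameters of the algorithm -/

def alpha (σx σy : ℝ) : ℝ := min 1 √(8 * σy / σx)

def etaZ (σx : ℝ) : ℝ := σx / 2

def etaY (σx σy : ℝ) : ℝ := min (1 / (2 * σy)) (4 / (alpha σx σy * σx))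

def beta (t : ℕ) : ℝ := 2 / ((t : ℝ) + 3)

def zeta (σx L : ℝ) : ℝ := (2 * √5 * (1 + 8 * L / σx))⁻¹

/-- The common value of `γ_x` and `γ_y`. -/
def gam (σx : ℝ) : ℝ := 8 * σx⁻¹

def zetaBar (σx σy L : ℝ) : ℝ := min σx σy / L ^ 2

/-! ## The algorithm -/

/-- The variables `z^k, y^k, z_f^k, y_f^k` of the outer loop. -/
structure Outer (n m : ℕ) where
  z : Vec n
  y : Vec m
  zf : Vec n
  yf : Vec m

/-- The variables `x^{k,t}, y^{k,t}, b_x^{k,t}, b_y^{k,t}` of the inner loop. -/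
structure Inner (n m : ℕ) where
  x : Vec n
  y : Vec m
  bx : Vec n
  bY : Vec m

/-- The oracle calls made so far: `grad` lists the points at which `∇ h` was evaluated, and `proxP`
(`proxQ`) the pairs `(c, v)` for which `prox_{c p}(v)` (`prox_{c q}(v)`) was evaluated. -/
structure Log (n m : ℕ) where
  grad : List (Pt n m)
  proxP : List (ℝ × Vec n)
  proxQ : List (ℝ × Vec m)

def Log.append (l l' : Log n m) : Log n m :=
  ⟨l.grad ++ l'.grad, l.proxP ++ l'.proxP, l.proxQ ++ l'.proxQ⟩

/-- The control states: the beginning of iteration `k`; the test of the inner loop in iteration `k`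
after `t` inner iterations (with `i0` the variables of index `0` and `i` those of index `t`);
termination with the output `(x, y)` after `K` iterations. -/
inductive Config (n m : ℕ) where
  | outer (k : ℕ) (s : Outer n m)
  | inner (k : ℕ) (s : Outer n m) (t : ℕ) (i0 i : Inner n m)
  | done (K : ℕ) (x : Vec n) (y : Vec m)

namespace Input

variable (I : Input n m)

def gx (x : Vec n) (y : Vec m) : Vec n := (gradient I.h (pair x y)).fst

def gy (x : Vec n) (y : Vec m) : Vec m := (gradient I.h (pair x y)).snd

/-- `ĥ(x, y) = h(x, y) - σx ‖x‖² / 2 + σy ‖y‖² / 2`. -/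
def hHat (x : Vec n) (y : Vec m) : ℝ :=
  I.h (pair x y) - I.σx * ‖x‖ ^ 2 / 2 + I.σy * ‖y‖ ^ 2 / 2

/-- `∇_x ĥ(x, y)`, obtained from `∇ h(x, y)`. -/
def gxHat (x : Vec n) (y : Vec m) : Vec n := I.gx x y - I.σx • x

/-- `∇_y ĥ(x, y)`, obtained from `∇ h(x, y)`. -/
def gyHat (x : Vec n) (y : Vec m) : Vec m := I.gy x y + I.σy • y

def zg (s : Outer n m) : Vec n :=
  alpha I.σx I.σy • s.z + (1 - alpha I.σx I.σy) • s.zf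

def yg (s : Outer n m) : Vec m :=
  alpha I.σx I.σy • s.y + (1 - alpha I.σx I.σy) • s.yf

/-- `x^{k,-1}`; the companion `y^{k,-1}` is `y_g^k`. -/
def xInit (s : Outer n m) : Vec n := -(I.σx⁻¹ • I.zg s)

/-- `a_x^k(x, y)`. -/
def ax (s : Outer n m) (x : Vec n) (y : Vec m) : Vec n :=
  I.gxHat x y + (I.σx / 2) • (x - I.σx⁻¹ • I.zg s)

/-- `a_y^k(x, y)`. -/
def ay (s : Outer n m) (x : Vec n) (y : Vec m) : Vec m :=
  -I.gyHat x y + I.σy • y + (I.σx / 8) • (y - I.yg s)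

/-- The inner step size `ζ γ_x = ζ γ_y`. -/
def innerStep : ℝ := zeta I.σx I.L * gam I.σx

/-- The arguments of the proximal operators that produce `x^{k,0}` and `y^{k,0}`. -/
def startX (s : Outer n m) : Vec n :=
  I.xInit s - I.innerStep • I.ax s (I.xInit s) (I.yg s)

def startY (s : Outer n m) : Vec m :=
  I.yg s - I.innerStep • I.ay s (I.xInit s) (I.yg s)

/-- `x^{k,0}, y^{k,0}, b_x^{k,0}, b_y^{k,0}`. -/
def inner0 (s : Outer n m) : Inner n m where
  x := prox (scale I.innerStep I.p) (I.startX s)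
  y := prox (scale I.innerStep I.q) (I.startY s)
  bx := I.innerStep⁻¹ • (I.startX s - prox (scale I.innerStep I.p) (I.startX s))
  bY := I.innerStep⁻¹ • (I.startY s - prox (scale I.innerStep I.q) (I.startY s))

/-- The condition under which the inner loop goes on. -/
def LoopCond (s : Outer n m) (i : Inner n m) : Prop :=
  (gam I.σx)⁻¹ * ‖i.x - I.xInit s‖ ^ 2 + (gam I.σx)⁻¹ * ‖i.y - I.yg s‖ ^ 2 <
    gam I.σx * ‖I.ax s i.x i.y + i.bx‖ ^ 2 + gam I.σx * ‖I.ay s i.x i.y + i.bY‖ ^ 2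

/-- `x^{k,t+1/2}`. -/
def halfX (s : Outer n m) (t : ℕ) (i0 i : Inner n m) : Vec n :=
  i.x + beta t • (i0.x - i.x) - I.innerStep • (I.ax s i.x i.y + i.bx)

/-- `y^{k,t+1/2}`. -/
def halfY (s : Outer n m) (t : ℕ) (i0 i : Inner n m) : Vec m :=
  i.y + beta t • (i0.y - i.y) - I.innerStep • (I.ay s i.x i.y + i.bY)

/-- The arguments of the proximal operators that produce `x^{k,t+1}` and `y^{k,t+1}`. -/
def fullX (s : Outer n m) (t : ℕ) (i0 i : Inner n m) : Vec n :=
  i.x + beta t • (i0.x - i.x) - I.innerStep • I.ax s (I.halfX s t i0 i) (I.halfY s t i0 i)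

def fullY (s : Outer n m) (t : ℕ) (i0 i : Inner n m) : Vec m :=
  i.y + beta t • (i0.y - i.y) - I.innerStep • I.ay s (I.halfX s t i0 i) (I.halfY s t i0 i)

/-- `x^{k,t+1}, y^{k,t+1}, b_x^{k,t+1}, b_y^{k,t+1}`. -/
def innerNext (s : Outer n m) (t : ℕ) (i0 i : Inner n m) : Inner n m where
  x := prox (scale I.innerStep I.p) (I.fullX s t i0 i)
  y := prox (scale I.innerStep I.q) (I.fullY s t i0 i)
  bx := I.innerStep⁻¹ • (I.fullX s t i0 i - prox (scale I.innerStep I.p) (I.fullX s t i0 i))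
  bY := I.innerStep⁻¹ • (I.fullY s t i0 i - prox (scale I.innerStep I.q) (I.fullY s t i0 i))

/-- `z_f^{k+1}`, from the last inner variables `i`. -/
def zfNext (i : Inner n m) : Vec n := I.gxHat i.x i.y + i.bx

/-- `w_f^{k+1}`. -/
def wfNext (i : Inner n m) : Vec m := -I.gyHat i.x i.y + i.bY

/-- `z^{k+1}, y^{k+1}, z_f^{k+1}, y_f^{k+1}`. -/
def outerNext (s : Outer n m) (i : Inner n m) : Outer n m where
  z := s.z + (etaZ I.σx * I.σx⁻¹) • (I.zfNext i - s.z)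
    - etaZ I.σx • (i.x + I.σx⁻¹ • I.zfNext i)
  y := s.y + (etaY I.σx I.σy * I.σy) • (i.y - s.y)
    - etaY I.σx I.σy • (I.wfNext i + I.σy • i.y)
  zf := I.zfNext i
  yf := i.y

/-- `x^{k+1} = -σx⁻¹ z^{k+1}`, from the new outer variables `s`. -/
def xOf (s : Outer n m) : Vec n := -(I.σx⁻¹ • s.z)

/-- The step size of the forward-backward step. -/
def fbStep : ℝ := zetaBar I.σx I.σy I.L

/-- The arguments of the proximal operators in the forward-backward step. -/
def fbX (s : Outer n m) : Vec n := I.xOf s - I.fbStep • I.gx (I.xOf s) s.y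

def fbY (s : Outer n m) : Vec m := s.y + I.fbStep • I.gy (I.xOf s) s.y

/-- `x̃^{k+1}`. -/
def xTilde (s : Outer n m) : Vec n := prox (scale I.fbStep I.p) (I.fbX s)

/-- `ỹ^{k+1}`. -/
def yTilde (s : Outer n m) : Vec m := prox (scale I.fbStep I.q) (I.fbY s)

/-- The termination criterion, on the new outer variables `s`. -/
def Terminates (s : Outer n m) : Prop :=
  ‖I.fbStep⁻¹ • pair (I.xOf s - I.xTilde s) (I.yTilde s - s.y)
    - (gradient I.h (pair (I.xOf s) s.y) - gradient I.h (pair (I.xTilde s) (I.yTilde s)))‖ ≤ I.ε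

open Classical in
/-- One step of the algorithm, with the oracle calls made in it. A gradient that was evaluated at a
point is reused wherever the algorithm needs the gradient at that same iterate. -/
def step : Config n m → Config n m × Log n m
  | .outer k s =>
      (.inner k s 0 (I.inner0 s) (I.inner0 s),
        ⟨[pair (I.xInit s) (I.yg s)], [(I.innerStep, I.startX s)], [(I.innerStep, I.startY s)]⟩)
  | .inner k s t i0 i =>
      if I.LoopCond s i then
        (.inner k s (t + 1) i0 (I.innerNext s t i0 i),
          ⟨[pair i.x i.y, pair (I.halfX s t i0 i) (I.halfY s t i0 i)],
            [(I.innerStep, I.fullX s t i0 i)], [(I.innerStep, I.fullY s t i0 i)]⟩)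
      else
        let s' := I.outerNext s i
        (if I.Terminates s' then .done (k + 1) (I.xTilde s') (I.yTilde s') else .outer (k + 1) s',
          ⟨[pair i.x i.y, pair (I.xOf s') s'.y, pair (I.xTilde s') (I.yTilde s')],
            [(I.fbStep, I.fbX s')], [(I.fbStep, I.fbY s')]⟩)
  | .done K x y => (.done K x y, ⟨[], [], []⟩)

/-- The configuration after `j` steps and the oracle calls made until then. -/
def run : ℕ → Config n m × Log n m
  | 0 => (.outer 0 ⟨I.z0, I.y0, I.z0, I.y0⟩, ⟨[], [], []⟩)
  | j + 1 => ((I.step (run j).1).1, (run j).2.append (I.step (run j).1).2)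

/-! ## The quantities in the complexity bounds -/

/-- `G(z, y) = sup_x { ⟨x, z⟩ - p(x) - ĥ(x, y) + q(y) }`. -/
def G (z : Vec n) (y : Vec m) : EReal :=
  ⨆ x, (((inner ℝ x z - I.hHat x y : ℝ) : EReal) - I.p x + I.q y)

/-- `P(z, y) = σx⁻¹ ‖z‖² / 2 + σy ‖y‖² / 2 + G(z, y)`, for `y` in the domain of `q`. -/
def P (z : Vec n) (y : Vec m) : ℝ :=
  I.σx⁻¹ * ‖z‖ ^ 2 / 2 + I.σy * ‖y‖ ^ 2 / 2 + (I.G z y).toReal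

/-- `ϑ_0`, where `(xs, ys)` is the optimal solution and `z^* = -σx xs`. -/
def theta0 (xs : Vec n) (ys : Vec m) : ℝ :=
  (etaZ I.σx)⁻¹ * ‖I.z0 - -(I.σx • xs)‖ ^ 2 + (etaY I.σx I.σy)⁻¹ * ‖I.y0 - ys‖ ^ 2
    + 2 * (alpha I.σx I.σy)⁻¹ * (I.P I.z0 I.y0 - I.P (-(I.σx • xs)) ys)

/-- `K̄` for the value `θ` of `ϑ_0`. -/
def Kbar (θ : ℝ) : ℕ :=
  ⌈max (2 / alpha I.σx I.σy) (alpha I.σx I.σy * I.σx / (4 * I.σy)) *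
    Real.log (4 * max (etaZ I.σx * I.σx ^ (-2 : ℤ)) (etaY I.σx I.σy) * θ /
      (((zetaBar I.σx I.σy I.L)⁻¹ + I.L) ^ (-2 : ℤ) * I.ε ^ 2))⌉₊

/-- `δ̄`, with `D_x` and `D_y` the diameters of the domains of `p` and `q`. -/
def deltaBar : ℝ :=
  (2 + (alpha I.σx I.σy)⁻¹) * I.σx * Metric.diam (dom I.p) ^ 2
    + max (2 * I.σy) (alpha I.σx I.σy * I.σx / 4) * Metric.diam (dom I.q) ^ 2

/-- The first factor of `N̄` for the tolerance `ε`, a bound on the number of outer iterations. -/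
def Nouter (ε : ℝ) : ℕ :=
  ⌈max 2 √(I.σx / (2 * I.σy)) *
    Real.log (4 * max (1 / (2 * I.σx)) (min (1 / (2 * I.σy)) (4 / (alpha I.σx I.σy * I.σx))) *
      (I.deltaBar + 2 * (alpha I.σx I.σy)⁻¹ * (I.Hstar.toReal - I.Hlow.toReal)) /
      ((I.L ^ 2 / min I.σx I.σy + I.L) ^ (-2 : ℤ) * ε ^ 2))⌉₊

/-- `N̄` for the tolerance `ε`; the first factor is at least `1`, since the algorithm always
performs one outer iteration. -/
def Nbar (ε : ℝ) : ℕ :=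
  max 1 (I.Nouter ε) * (⌈96 * √2 * (1 + 8 * I.L * I.σx⁻¹)⌉₊ + 2)

end Input

end Minimax

end

/-!
The problem is a saddle point problem for the operator `(∇_x h, -∇_y h)` plus the subdifferential of
`p(x) + q(y)`. The operator is strongly monotone and Lipschitz on `U × V`, so a forward-backward map is a
contraction of the compact set `dom p × dom q`, and its fixed point is the unique optimal solution
(`exists_isSubgradPair_neg`, `IsSaddle.isOptimal`, `IsSaddle.eq_of_isOptimal`). No minimax theorem is
needed.

The outer loop is an accelerated inexact proximal point method for the strongly convex function
`P(z, y)`, whose minimizer is `(-σx x^*, y^*)`. A subgradient `b_x` of `p` and `b_y` of `q` at the inner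
solution gives a subgradient of `P` at `(z_f, y_f)` (`P_strongConvex`), and the stopping test of the inner
loop says that this subgradient points back to the extrapolated point `(z_g, y_g)`
(`inner_le_of_accuracy`). Together with strong convexity this contracts the potential `ϑ` by the factor
`1 - α / 2` (`potential_contraction`, `theta_outerNext_le`); both numbers in the maximum that defines
`K̄` are at most `2 / α` (`rate_eq`). Since `ϑ` dominates the squared distance to the solution and the
final forward-backward step is nonexpansive towards it, the termination test succeeds after `K̄`
iterations (`terminates_of_Kbar_le`); the vector in that test is an element of the subdifferential at
the output (`isStationary_of_terminates`).

The inner loop is an anchored extragradient method for a monotone inclusion. Its potential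
`(t + 1)(t + 2)((t + 3)/4 ‖g‖² + ⟨g, u - u₀⟩)`, in the scaled residual `g`, decreases if the step size is
at most `1 / √5` of the inverse Lipschitz constant (`anchorPotential_succ_le`). So the residual decays
like `1 / t`, and by strong monotonicity of the subproblem the stopping test is met after
`64 (1 + 8 L / σx)` steps (`anchored_residual_le`, `exists_not_loopCond`). That leaves room for the
constant in `N̄` (`innerBound_cost`). The bound by `N̄` then follows from estimating the initial potential
by the diameters of the domains and the range of `H` (`IsSaddle.theta0_le`).
-/

namespace Minimax

variable {n m : ℕ}

/-! ### Convex subgradients and the proximal operator -/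

/-- `s` is a subgradient, in the sense of convex analysis, of `φ` at the point `x` of its domain. The
values of `φ` are turned into real numbers, which loses nothing on `dom φ` if `φ` is never `-∞`. -/
def IsSubgrad (φ : Vec n → EReal) (x s : Vec n) : Prop :=
  x ∈ dom φ ∧ ∀ x' ∈ dom φ, (φ x).toReal + inner ℝ s (x' - x) ≤ (φ x').toReal

theorem ProperClosedConvex.coe_toReal {φ : Vec n → EReal} (hφ : ProperClosedConvex φ) {x : Vec n}
    (hx : x ∈ dom φ) : ((φ x).toReal : EReal) = φ x :=
  EReal.coe_toReal (ne_of_lt hx) (hφ.ne_bot x)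

theorem IsSubgrad.monotone {φ : Vec n → EReal} {x s x' s' : Vec n} (h : IsSubgrad φ x s)
    (h' : IsSubgrad φ x' s') : 0 ≤ inner ℝ (s - s') (x - x') := by
  have h1 := h.2 x' h'.1
  have h2 := h'.2 x h.1
  simp only [inner_sub_left, inner_sub_right] at *
  linarith

theorem ProperClosedConvex.toReal_combo_le {φ : Vec n → EReal} (hφ : ProperClosedConvex φ)
    {x x' : Vec n} (hx : x ∈ dom φ) (hx' : x' ∈ dom φ) {a b : ℝ} (ha : 0 ≤ a) (hb : 0 ≤ b)
    (hab : a + b = 1) :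
    a • x + b • x' ∈ dom φ ∧
      (φ (a • x + b • x')).toReal ≤ a * (φ x).toReal + b * (φ x').toReal := by
  have h := hφ.convex (x := (x, (φ x).toReal)) (y := (x', (φ x').toReal))
    (by simp [hφ.coe_toReal hx]) (by simp [hφ.coe_toReal hx']) ha hb hab
  have h' : φ (a • x + b • x') ≤ ((a * (φ x).toReal + b * (φ x').toReal : ℝ) : EReal) := by
    simpa using h
  have hd : a • x + b • x' ∈ dom φ := lt_of_le_of_lt h' (EReal.coe_lt_top _)
  refine ⟨hd, ?_⟩
  rw [← hφ.coe_toReal hd] at h'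
  exact_mod_cast h'

theorem prox_isMin {φ : Vec n → EReal} (hφ : ProperClosedConvex φ) (hc : IsCompact (dom φ)) {c : ℝ}
    (hc0 : 0 < c) (v : Vec n) :
    prox (scale c φ) v ∈ dom φ ∧ ∀ x' ∈ dom φ,
      ‖prox (scale c φ) v - v‖ ^ 2 / 2 + c * (φ (prox (scale c φ) v)).toReal ≤
        ‖x' - v‖ ^ 2 / 2 + c * (φ x').toReal := by
  have hval : ∀ x ∈ dom φ, ((‖x - v‖ ^ 2 / 2 : ℝ) : EReal) + scale c φ x
      = ((‖x - v‖ ^ 2 / 2 + c * (φ x).toReal : ℝ) : EReal) := by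
    intro x hx
    rw [scale, EReal.coe_add, EReal.coe_mul, hφ.coe_toReal hx]
  have htop : ∀ x ∉ dom φ, ((‖x - v‖ ^ 2 / 2 : ℝ) : EReal) + scale c φ x = ⊤ := by
    intro x hx
    have : φ x = ⊤ := by simpa [dom] using hx
    rw [scale, this, EReal.coe_mul_top_of_pos hc0, EReal.coe_add_top]
  have hex : ∃ x, ∀ x', ((‖x - v‖ ^ 2 / 2 : ℝ) : EReal) + scale c φ x
      ≤ ((‖x' - v‖ ^ 2 / 2 : ℝ) : EReal) + scale c φ x' := by
    -- the objective is divided by `c`, so that `φ` itself is what is added to a continuous function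
    have hlsc : LowerSemicontinuous fun x => (((‖x - v‖ ^ 2 / 2) / c : ℝ) : EReal) + φ x := by
      refine LowerSemicontinuous.add' (Continuous.lowerSemicontinuous ?_) hφ.closed fun x => ?_
      · exact continuous_coe_real_ereal.comp (by fun_prop)
      · exact EReal.continuousAt_add (Or.inl (EReal.coe_ne_top _)) (Or.inl (EReal.coe_ne_bot _))
    obtain ⟨x, hx, hmin⟩ := (hlsc.lowerSemicontinuousOn (dom φ)).exists_isMinOn hφ.proper hc
    refine ⟨x, fun x' => ?_⟩
    by_cases hx' : x' ∈ dom φ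
    · have h : (((‖x - v‖ ^ 2 / 2) / c : ℝ) : EReal) + φ x
        ≤ (((‖x' - v‖ ^ 2 / 2) / c : ℝ) : EReal) + φ x' := hmin hx'
      rw [← hφ.coe_toReal hx, ← hφ.coe_toReal hx', ← EReal.coe_add, ← EReal.coe_add,
        EReal.coe_le_coe_iff] at h
      rw [hval x hx, hval x' hx', EReal.coe_le_coe_iff]
      have h' := mul_le_mul_of_nonneg_left h hc0.le
      rwa [mul_add, mul_add, mul_div_cancel₀ _ hc0.ne', mul_div_cancel₀ _ hc0.ne'] at h'
    · rw [htop x' hx']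
      exact le_top
  have hspec : ∀ x', ((‖prox (scale c φ) v - v‖ ^ 2 / 2 : ℝ) : EReal)
      + scale c φ (prox (scale c φ) v) ≤ ((‖x' - v‖ ^ 2 / 2 : ℝ) : EReal) + scale c φ x' :=
    Classical.epsilon_spec hex
  have hmem : prox (scale c φ) v ∈ dom φ := by
    by_contra hcon
    obtain ⟨x₀, hx₀⟩ := hφ.proper
    have h := hspec x₀
    rw [htop _ hcon, hval x₀ hx₀] at h
    exact EReal.coe_ne_top _ (top_le_iff.mp h)
  refine ⟨hmem, fun x' hx' => ?_⟩
  have h := hspec x'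
  rw [hval _ hmem, hval _ hx'] at h
  exact_mod_cast h

theorem nonneg_of_forall_quadratic {a M : ℝ}
    (h : ∀ t : ℝ, 0 < t → t ≤ 1 → 0 ≤ t * a + t ^ 2 * M) : 0 ≤ a := by
  have hlim : Tendsto (fun t : ℝ => a + t * M) (𝓝[>] 0) (𝓝 (a + 0 * M)) :=
    (Continuous.tendsto (by fun_prop) 0).mono_left nhdsWithin_le_nhds
  have := ge_of_tendsto (b := (0 : ℝ)) hlim (by
    filter_upwards [Ioc_mem_nhdsGT (zero_lt_one' ℝ)] with t ht
    have := h t ht.1 ht.2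
    have h2 : 0 ≤ t * (a + t * M) := by linarith [this]
    exact nonneg_of_mul_nonneg_right h2 ht.1)
  simpa using this

theorem prox_isSubgrad {φ : Vec n → EReal} (hφ : ProperClosedConvex φ) (hc : IsCompact (dom φ))
    {c : ℝ} (hc0 : 0 < c) (v : Vec n) :
    IsSubgrad φ (prox (scale c φ) v) (c⁻¹ • (v - prox (scale c φ) v)) := by
  obtain ⟨hmem, hmin⟩ := prox_isMin hφ hc hc0 v
  set x := prox (scale c φ) v
  refine ⟨hmem, fun x' hx' => ?_⟩
  have key : 0 ≤ inner ℝ (x - v) (x' - x) + c * ((φ x').toReal - (φ x).toReal) := by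
    refine nonneg_of_forall_quadratic (M := ‖x' - x‖ ^ 2 / 2) fun t ht ht1 => ?_
    obtain ⟨hd, hle⟩ := hφ.toReal_combo_le hmem hx' (sub_nonneg.2 ht1) ht.le (by ring)
    have h1 := hmin _ hd
    have h2 : (1 - t) • x + t • x' - v = (x - v) + t • (x' - x) := by module
    rw [h2, norm_add_sq_real, norm_smul, inner_smul_right, Real.norm_eq_abs, mul_pow, sq_abs] at h1
    nlinarith [mul_le_mul_of_nonneg_left hle hc0.le]
  have h3 : inner ℝ (c⁻¹ • (v - x)) (x' - x) = - (c⁻¹ * inner ℝ (x - v) (x' - x)) := by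
    rw [inner_smul_left, ← neg_sub x v, inner_neg_left]
    simp
  rw [h3]
  have h4 := mul_nonneg (inv_nonneg.2 hc0.le) key
  rw [mul_add, inv_mul_cancel_left₀ hc0.ne'] at h4
  linarith

theorem ProperClosedConvex.exists_isSubgrad {φ : Vec n → EReal} (hφ : ProperClosedConvex φ)
    (hc : IsCompact (dom φ)) : ∃ x s, IsSubgrad φ x s :=
  ⟨_, _, prox_isSubgrad hφ hc one_pos 0⟩

/-! ### Subgradients and proximal steps on the product space -/

theorem pair_fst (x : Vec n) (y : Vec m) : (pair x y).fst = x := rfl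

theorem pair_snd (x : Vec n) (y : Vec m) : (pair x y).snd = y := rfl

theorem pair_eta (w : Pt n m) : pair w.fst w.snd = w := rfl

theorem Pt.ext {w w' : Pt n m} (h1 : w.fst = w'.fst) (h2 : w.snd = w'.snd) : w = w' := by
  rw [← pair_eta w, ← pair_eta w', h1, h2]

theorem norm_sq_pt (w : Pt n m) : ‖w‖ ^ 2 = ‖w.fst‖ ^ 2 + ‖w.snd‖ ^ 2 :=
  WithLp.prod_norm_sq_eq_of_L2 w

theorem inner_pt (w w' : Pt n m) :
    inner ℝ w w' = inner ℝ w.fst w'.fst + inner ℝ w.snd w'.snd :=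
  WithLp.prod_inner_apply w w'

/-- `s` is a subgradient at `w` of the function `(x, y) ↦ p x + q y`. -/
def IsSubgradPair (p : Vec n → EReal) (q : Vec m → EReal) (w s : Pt n m) : Prop :=
  IsSubgrad p w.fst s.fst ∧ IsSubgrad q w.snd s.snd

theorem IsSubgradPair.monotone {p : Vec n → EReal} {q : Vec m → EReal} {w s w' s' : Pt n m}
    (h : IsSubgradPair p q w s) (h' : IsSubgradPair p q w' s') :
    0 ≤ inner ℝ (s - s') (w - w') := by
  rw [inner_pt]
  exact add_nonneg (h.1.monotone h'.1) (h.2.monotone h'.2)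

theorem IsSubgradPair.mem_box {p : Vec n → EReal} {q : Vec m → EReal} {w s : Pt n m}
    (h : IsSubgradPair p q w s) : w ∈ box (dom p) (dom q) := ⟨h.1.1, h.2.1⟩

/-- The proximal map is nonexpansive. The hypotheses say that `w` and `w'` are the images of `v` and
`v'` under the proximal map with step size `c`. -/
theorem IsSubgradPair.norm_sub_le {p : Vec n → EReal} {q : Vec m → EReal}
    {w v w' v' : Pt n m} {c : ℝ} (hc : 0 < c) (h : IsSubgradPair p q w (c⁻¹ • (v - w)))
    (h' : IsSubgradPair p q w' (c⁻¹ • (v' - w'))) : ‖w - w'‖ ≤ ‖v - v'‖ := by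
  have h1 := h.monotone h'
  rw [← smul_sub, inner_smul_left] at h1
  have h2 : 0 ≤ inner ℝ (v - w - (v' - w')) (w - w') :=
    nonneg_of_mul_nonneg_right h1 (by simpa using hc)
  have h3 : v - w - (v' - w') = (v - v') - (w - w') := by abel
  rw [h3, inner_sub_left, real_inner_self_eq_norm_sq] at h2
  have h4 := real_inner_le_norm (v - v') (w - w')
  by_contra! hlt
  nlinarith [norm_nonneg (v - v'), norm_nonneg (w - w')]

theorem norm_forward_sq_le {E : Type*} [NormedAddCommGroup E] [InnerProductSpace ℝ E] {w w' a a' : E}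
    {μ ℓ c : ℝ} (hc : 0 ≤ c) (hmono : μ * ‖w - w'‖ ^ 2 ≤ inner ℝ (a - a') (w - w'))
    (hlip : ‖a - a'‖ ≤ ℓ * ‖w - w'‖) :
    ‖(w - c • a) - (w' - c • a')‖ ^ 2 ≤ (1 - 2 * c * μ + (c * ℓ) ^ 2) * ‖w - w'‖ ^ 2 := by
  have h1 : (w - c • a) - (w' - c • a') = (w - w') - c • (a - a') := by module
  rw [h1, norm_sub_sq_real, norm_smul, inner_smul_right, real_inner_comm, mul_pow,
    Real.norm_eq_abs, sq_abs]
  have h2 : ‖a - a'‖ ^ 2 ≤ (ℓ * ‖w - w'‖) ^ 2 := pow_le_pow_left₀ (norm_nonneg _) hlip 2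
  nlinarith [mul_le_mul_of_nonneg_left hmono hc, mul_le_mul_of_nonneg_left h2 (sq_nonneg c)]

theorem isSubgradPair_prox {p : Vec n → EReal} {q : Vec m → EReal} (hp : ProperClosedConvex p)
    (hq : ProperClosedConvex q) (hpc : IsCompact (dom p)) (hqc : IsCompact (dom q)) {c : ℝ}
    (hc : 0 < c) (v : Pt n m) :
    IsSubgradPair p q (pair (prox (scale c p) v.fst) (prox (scale c q) v.snd))
      (c⁻¹ • (v - pair (prox (scale c p) v.fst) (prox (scale c q) v.snd))) :=
  ⟨prox_isSubgrad hp hpc hc _, prox_isSubgrad hq hqc hc _⟩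

/-- A strongly monotone Lipschitz operator plus a subdifferential has a zero: for a small step the
forward-backward map is a contraction of the (complete) domain, and its fixed point is a zero. -/
theorem exists_isSubgradPair_neg {p : Vec n → EReal} {q : Vec m → EReal} (hp : ProperClosedConvex p)
    (hq : ProperClosedConvex q) (hpc : IsCompact (dom p)) (hqc : IsCompact (dom q))
    (A : Pt n m → Pt n m) {μ ℓ : ℝ} (hμ : 0 < μ) (hℓ : 0 < ℓ)
    (hmono : ∀ w ∈ box (dom p) (dom q), ∀ w' ∈ box (dom p) (dom q),
      μ * ‖w - w'‖ ^ 2 ≤ inner ℝ (A w - A w') (w - w'))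
    (hlip : ∀ w ∈ box (dom p) (dom q), ∀ w' ∈ box (dom p) (dom q),
      ‖A w - A w'‖ ≤ ℓ * ‖w - w'‖) :
    ∃ w, IsSubgradPair p q w (-A w) := by
  set c : ℝ := μ / ℓ ^ 2 with hcdef
  have hc : 0 < c := by positivity
  set T : Pt n m → Pt n m := fun w =>
    pair (prox (scale c p) (w - c • A w).fst) (prox (scale c q) (w - c • A w).snd) with hT
  have hsub : ∀ w, IsSubgradPair p q (T w) (c⁻¹ • ((w - c • A w) - T w)) := fun w =>
    isSubgradPair_prox hp hq hpc hqc hc _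
  have hmaps : MapsTo T (box (dom p) (dom q)) (box (dom p) (dom q)) := fun w _ => (hsub w).mem_box
  have hclosed : IsClosed (box (dom p) (dom q) : Set (Pt n m)) :=
    (hpc.isClosed.preimage (WithLp.continuous_fst 2 _ _)).inter
      (hqc.isClosed.preimage (WithLp.continuous_snd 2 _ _))
  have hk : 1 - 2 * c * μ + (c * ℓ) ^ 2 = 1 - μ ^ 2 / ℓ ^ 2 := by
    rw [hcdef]; field_simp; ring
  have hK : √(1 - μ ^ 2 / ℓ ^ 2) < 1 := by
    rw [Real.sqrt_lt' one_pos]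
    have : 0 < μ ^ 2 / ℓ ^ 2 := by positivity
    linarith
  have hcontr : ContractingWith ⟨√(1 - μ ^ 2 / ℓ ^ 2), Real.sqrt_nonneg _⟩
      (hmaps.restrict T _ _) := by
    refine ⟨by exact_mod_cast hK, LipschitzWith.of_dist_le_mul fun w w' => ?_⟩
    change dist (T w) (T w') ≤ √(1 - μ ^ 2 / ℓ ^ 2) * dist (w : Pt n m) w'
    rw [dist_eq_norm, dist_eq_norm]
    refine ((hsub w).norm_sub_le hc (hsub w')).trans ?_
    have h := norm_forward_sq_le hc.le (hmono w w.2 w' w'.2) (hlip w w.2 w' w'.2)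
    rw [hk] at h
    refine (Real.le_sqrt_of_sq_le h).trans_eq ?_
    rw [Real.sqrt_mul' _ (sq_nonneg _), Real.sqrt_sq (norm_nonneg _)]
  obtain ⟨x₀, hx₀⟩ := hp.proper
  obtain ⟨y₀, hy₀⟩ := hq.proper
  obtain ⟨w, -, hw, -⟩ := hcontr.exists_fixedPoint' hclosed.isComplete hmaps
    (x := pair x₀ y₀) ⟨hx₀, hy₀⟩ (edist_ne_top _ _)
  refine ⟨w, ?_⟩
  have h := hsub w
  rw [hw.eq] at h
  have h2 : c⁻¹ • (w - c • A w - w) = -A w := by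
    rw [sub_sub_cancel_left, smul_neg, inv_smul_smul₀ hc.ne']
  rwa [h2] at h

/-! ### Smooth strongly-convex-strongly-concave functions -/

theorem hasDerivAt_line {E : Type*} [NormedAddCommGroup E] [InnerProductSpace ℝ E] [CompleteSpace E]
    {f : E → ℝ} {x : E} (hf : DifferentiableAt ℝ f x) (d : E) :
    HasDerivAt (fun t : ℝ => f (x + t • d)) (inner ℝ (gradient f x) d) 0 := by
  have h1 : HasDerivAt (fun t : ℝ => x + t • d) d 0 := by
    simpa using ((hasDerivAt_id (0 : ℝ)).smul_const d).const_add x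
  have h2 := hf.hasGradientAt.hasFDerivAt
  have h3 : HasFDerivAt f (InnerProductSpace.toDual ℝ E (gradient f x)) (x + (0 : ℝ) • d) := by
    simpa using h2
  have h4 := h3.comp_hasDerivAt (0 : ℝ) h1
  rw [InnerProductSpace.toDual_apply_apply] at h4
  exact h4

theorem deriv_le_of_forall_quadratic {φ : ℝ → ℝ} {φ' c M : ℝ} (hd : HasDerivAt φ φ' 0)
    (h : ∀ t : ℝ, 0 < t → t ≤ 1 → φ t ≤ φ 0 + t * c + t ^ 2 * M) : φ' ≤ c := by
  have h1 := (hasDerivAt_iff_tendsto_slope_zero.1 hd).mono_left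
    (nhdsWithin_mono (0 : ℝ) (show Ioi (0 : ℝ) ⊆ {0}ᶜ from fun t ht => ne_of_gt ht))
  have h2 : Tendsto (fun t : ℝ => c + t * M) (𝓝[>] 0) (𝓝 (c + 0 * M)) :=
    (Continuous.tendsto (by fun_prop) 0).mono_left nhdsWithin_le_nhds
  have h3 := le_of_tendsto_of_tendsto h1 h2 (by
    filter_upwards [Ioc_mem_nhdsGT (zero_lt_one' ℝ)] with t ht
    have h4 := h t ht.1 ht.2
    rw [zero_add, smul_eq_mul, inv_mul_le_iff₀ ht.1]
    linarith)
  simpa using h3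

/-- The operator `(∇_x h, -∇_y h)` of the saddle point problem for `h`. -/
noncomputable def saddleOp (h : Pt n m → ℝ) (w : Pt n m) : Pt n m :=
  pair (gradient h w).fst (-(gradient h w).snd)

section

variable {h : Pt n m → ℝ} {σx σy L : ℝ} {U : Set (Vec n)} {V : Set (Vec m)}

theorem StronglyConvexConcaveOn.firstOrder_fst (hh : StronglyConvexConcaveOn h σx σy U V)
    {x x' : Vec n} {y : Vec m} (hx : x ∈ U) (hx' : x' ∈ U) (hy : y ∈ V)
    (hd : DifferentiableAt ℝ h (pair x y)) :
    h (pair x y) + inner ℝ (gradient h (pair x y)).fst (x' - x) + σx / 2 * ‖x' - x‖ ^ 2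
      ≤ h (pair x' y) := by
  have h1 := hasDerivAt_line hd (pair (x' - x) 0)
  have h2 : inner ℝ (gradient h (pair x y)) (pair (x' - x) 0)
      = inner ℝ (gradient h (pair x y)).fst (x' - x) := by
    rw [inner_pt, pair_fst, pair_snd, inner_zero_right, add_zero]
  rw [h2] at h1
  have h3 := deriv_le_of_forall_quadratic (M := σx / 2 * ‖x' - x‖ ^ 2)
    (c := h (pair x' y) - h (pair x y) - σx / 2 * ‖x' - x‖ ^ 2) h1 (by
      intro t ht ht1
      have h4 := (hh.1 y hy).2 hx hx' (sub_nonneg.2 ht1) ht.le (by ring)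
      have h5 : pair x y + t • pair (x' - x) 0 = pair ((1 - t) • x + t • x') y := by
        refine Pt.ext ?_ ?_
        · change x + t • (x' - x) = (1 - t) • x + t • x'
          module
        · change y + t • (0 : Vec m) = y
          simp
      simp only [smul_eq_mul] at h4
      rw [norm_sub_rev] at h4
      rw [h5, zero_smul, add_zero]
      linarith)
  linarith

theorem StronglyConvexConcaveOn.firstOrder_snd (hh : StronglyConvexConcaveOn h σx σy U V)
    {x : Vec n} {y y' : Vec m} (hx : x ∈ U) (hy : y ∈ V) (hy' : y' ∈ V)
    (hd : DifferentiableAt ℝ h (pair x y)) :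
    h (pair x y') ≤ h (pair x y) + inner ℝ (gradient h (pair x y)).snd (y' - y)
      - σy / 2 * ‖y' - y‖ ^ 2 := by
  have h1 := (hasDerivAt_line hd (pair 0 (y' - y))).neg
  have h2 : inner ℝ (gradient h (pair x y)) (pair 0 (y' - y))
      = inner ℝ (gradient h (pair x y)).snd (y' - y) := by
    rw [inner_pt, pair_fst, pair_snd, inner_zero_right, zero_add]
  rw [h2] at h1
  have h3 := deriv_le_of_forall_quadratic (M := σy / 2 * ‖y' - y‖ ^ 2)
    (c := h (pair x y) - h (pair x y') - σy / 2 * ‖y' - y‖ ^ 2) h1 (by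
      intro t ht ht1
      have h4 := (hh.2 x hx).2 hy hy' (sub_nonneg.2 ht1) ht.le (by ring)
      have h5 : pair x y + t • pair 0 (y' - y) = pair x ((1 - t) • y + t • y') := by
        refine Pt.ext ?_ ?_
        · change x + t • (0 : Vec n) = x
          simp
        · change y + t • (y' - y) = (1 - t) • y + t • y'
          module
      simp only [smul_eq_mul] at h4
      rw [norm_sub_rev] at h4
      simp only [Pi.neg_apply]
      rw [h5, zero_smul, add_zero]
      linarith)
  linarith

theorem saddleOp_monotone (hh : StronglyConvexConcaveOn h σx σy U V)
    (hd : SmoothOn h L (box U V)) {w w' : Pt n m} (hw : w ∈ box U V) (hw' : w' ∈ box U V) :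
    σx * ‖w.fst - w'.fst‖ ^ 2 + σy * ‖w.snd - w'.snd‖ ^ 2
      ≤ inner ℝ (saddleOp h w - saddleOp h w') (w - w') := by
  have d := hd.1 w hw
  have d' := hd.1 w' hw'
  have h1 := hh.firstOrder_fst hw.1 hw'.1 hw.2 d
  have h2 := hh.firstOrder_fst hw'.1 hw.1 hw'.2 d'
  have h3 := hh.firstOrder_snd hw.1 hw.2 hw'.2 d
  have h4 := hh.firstOrder_snd hw'.1 hw'.2 hw.2 d'
  rw [norm_sub_rev] at h1 h3
  simp only [pair_eta] at h1 h2 h3 h4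
  rw [inner_pt]
  change _ ≤ inner ℝ ((gradient h w).fst - (gradient h w').fst) (w.fst - w'.fst) +
    inner ℝ (-(gradient h w).snd - -(gradient h w').snd) (w.snd - w'.snd)
  simp only [inner_sub_left, inner_sub_right, inner_neg_left] at *
  linarith

theorem saddleOp_norm_sub (w w' : Pt n m) :
    ‖saddleOp h w - saddleOp h w'‖ = ‖gradient h w - gradient h w'‖ := by
  have : ‖saddleOp h w - saddleOp h w'‖ ^ 2 = ‖gradient h w - gradient h w'‖ ^ 2 := by
    rw [norm_sq_pt, norm_sq_pt]
    change ‖(gradient h w).fst - (gradient h w').fst‖ ^ 2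
      + ‖-(gradient h w).snd - -(gradient h w').snd‖ ^ 2
      = ‖(gradient h w).fst - (gradient h w').fst‖ ^ 2
      + ‖(gradient h w).snd - (gradient h w').snd‖ ^ 2
    rw [← neg_sub', norm_neg]
  exact (sq_eq_sq₀ (norm_nonneg _) (norm_nonneg _)).1 this

theorem saddleOp_lipschitz (hd : SmoothOn h L (box U V)) {w w' : Pt n m} (hw : w ∈ box U V)
    (hw' : w' ∈ box U V) : ‖saddleOp h w - saddleOp h w'‖ ≤ L * ‖w - w'‖ := by
  rw [saddleOp_norm_sub]
  exact hd.2 w hw w' hw'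

/-- Strong convexity with modulus `σx` forces `σx ≤ L`, unless it is void. -/
theorem modulus_le_lipschitz (hh : StronglyConvexConcaveOn h σx σy U V)
    (hd : SmoothOn h L (box U V)) (hV : V.Nonempty) : U.Subsingleton ∨ σx ≤ L := by
  by_contra! hcon
  obtain ⟨hU, hLσ⟩ := hcon
  obtain ⟨x, hx, x', hx', hne⟩ := hU
  obtain ⟨y, hy⟩ := hV
  have hw : pair x y ∈ box U V := ⟨hx, hy⟩
  have hw' : pair x' y ∈ box U V := ⟨hx', hy⟩
  have h1 := saddleOp_monotone hh hd hw hw'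
  have h2 := real_inner_le_norm (saddleOp h (pair x y) - saddleOp h (pair x' y))
    (pair x y - pair x' y)
  have h3 := saddleOp_lipschitz hd hw hw'
  have h4 : ‖pair x y - pair x' y‖ ^ 2 = ‖x - x'‖ ^ 2 := by
    rw [norm_sq_pt]
    change ‖x - x'‖ ^ 2 + ‖y - y‖ ^ 2 = _
    simp
  change σx * ‖x - x'‖ ^ 2 + σy * ‖y - y‖ ^ 2 ≤ _ at h1
  rw [sub_self, norm_zero] at h1
  have h5 : 0 < ‖x - x'‖ ^ 2 := by
    have := norm_pos_iff.2 (sub_ne_zero.2 hne)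
    positivity
  have h6 := mul_le_mul_of_nonneg_right h3 (norm_nonneg (pair x y - pair x' y))
  rw [mul_assoc, ← sq, h4] at h6
  linarith [mul_lt_mul_of_pos_right hLσ h5]

end

/-! ### The anchored extragradient method -/

/-- The potential of the anchored extragradient method: `g` is the residual at the iterate `u`, scaled
by the step size, and `u₀` is the anchor. -/
noncomputable def anchorPotential {E : Type*} [NormedAddCommGroup E] [InnerProductSpace ℝ E]
    (u₀ : E) (t : ℕ) (g u : E) : ℝ :=
  ((t : ℝ) + 1) * (t + 2) * ((t + 3) / 4 * ‖g‖ ^ 2 + inner ℝ g (u - u₀))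

/-- The potential decreases along an anchored extragradient step. Here `a` is the scaled residual
built from the half step, so that `g' - a` and `g - a` are the scaled differences of the operator and
of the points at `u'` and the half step. -/
theorem anchorPotential_succ_le {E : Type*} [NormedAddCommGroup E] [InnerProductSpace ℝ E]
    {u₀ u u' g g' a : E} (t : ℕ) (hu' : u' = u + beta t • (u₀ - u) - a)
    (hmono : 0 ≤ inner ℝ (g' - g) (u' - u)) (hlip : 5 * ‖g' - a‖ ^ 2 ≤ ‖g - a‖ ^ 2) :
    anchorPotential u₀ (t + 1) g' u' ≤ anchorPotential u₀ t g u := by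
  have ht : (0 : ℝ) ≤ t := t.cast_nonneg
  -- the multiplier of the monotonicity term cancels all inner products with `u - u₀`
  have key : anchorPotential u₀ t g u - anchorPotential u₀ (t + 1) g' u'
      = ((t : ℝ) + 1) * (t + 2) * (t + 3) / 2 * inner ℝ (g' - g) (u' - u)
        + (t + 2) * (t + 3) / 4 *
          (‖(2 : ℝ) • a - g'‖ ^ 2 + (t + 1) * ‖g - a‖ ^ 2 - (t + 5) * ‖g' - a‖ ^ 2) := by
    have e1 : u' - u₀ = (1 - beta t) • (u - u₀) - a := by rw [hu']; module
    have e2 : u' - u = -(beta t • (u - u₀)) - a := by rw [hu']; module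
    have h3 : (t : ℝ) + 3 ≠ 0 := by positivity
    rw [anchorPotential, anchorPotential, e1, e2]
    simp only [← real_inner_self_eq_norm_sq, inner_sub_left, inner_sub_right, inner_neg_right,
      inner_smul_left, inner_smul_right, conj_trivial]
    rw [real_inner_comm g' a, real_inner_comm g a]
    simp only [beta]
    push_cast
    field_simp
    ring
  -- this is where the Lipschitz bound `1 / √5` comes from: `(t + 5) / 5 ≤ t + 1`, tight for `t = 0`
  have h2 : 0 ≤ ((t : ℝ) + 1) * ‖g - a‖ ^ 2 - (t + 5) * ‖g' - a‖ ^ 2 := by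
    nlinarith [sq_nonneg ‖g - a‖, sq_nonneg ‖g' - a‖]
  have h3 : 0 ≤ ((t : ℝ) + 1) * (t + 2) * (t + 3) / 2 * inner ℝ (g' - g) (u' - u) := by positivity
  have h4 : 0 ≤ ((t : ℝ) + 2) * (t + 3) / 4 *
      (‖(2 : ℝ) • a - g'‖ ^ 2 + (t + 1) * ‖g - a‖ ^ 2 - (t + 5) * ‖g' - a‖ ^ 2) := by
    refine mul_nonneg (by positivity) ?_
    linarith [sq_nonneg ‖(2 : ℝ) • a - g'‖]
  linarith

/-- The residual bound in real numbers: `X` is the scaled residual after `T` steps, `X₀` that at the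
start, `R` and `R₀` are the distances of the point before the start and of the start from the zero.
The number `14` is not sharp: about `9` is enough, and `64 / (2 √5) > 14` is available. -/
theorem residual_le_of_potential {T ζ X X₀ R R₀ : ℝ} (hζ : 0 < ζ) (hζ' : ζ ≤ 1 / 4)
    (hT : 14 ≤ T * ζ) (hX : 0 ≤ X) (hX₀ : 0 ≤ X₀) (hR : 0 ≤ R) (hR₀ : R₀ ≤ 1.05 * R)
    (hX₀R : X₀ ≤ 1.3 * (R + R₀))
    (h : (T + 1) * (T + 2) * ((T + 3) / 4 * X ^ 2 - X * R₀) ≤ 3 / 2 * X₀ ^ 2) :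
    X ≤ ζ * R / 2 := by
  have hT0 : 56 ≤ T := by nlinarith
  by_contra! hlt
  have hXpos : 0 < X := lt_of_le_of_lt (by positivity) hlt
  have h1 : 7 * R ≤ T * X := by nlinarith
  have h2 : X * (0.7 * R) + 3 / 4 * X ^ 2 ≤ (T + 3) / 4 * X ^ 2 - X * R₀ := by nlinarith
  have h3 : X₀ ^ 2 ≤ 7.2 * R ^ 2 := by
    have h4 : X₀ ≤ 2.665 * R := by linarith
    nlinarith
  have h5 : T * T ≤ (T + 1) * (T + 2) := by nlinarith
  have h6 : 0 < 3 / 4 * X ^ 2 := by positivity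
  have h7 : T * T * (X * (0.7 * R) + 3 / 4 * X ^ 2)
      ≤ (T + 1) * (T + 2) * ((T + 3) / 4 * X ^ 2 - X * R₀) :=
    mul_le_mul h5 h2 (by positivity) (by positivity)
  have h8 : 56 * (7 * R) * (0.7 * R) ≤ T * (T * X) * (0.7 * R) :=
    mul_le_mul_of_nonneg_right (mul_le_mul hT0 h1 (by positivity) (by linarith)) (by positivity)
  have h9 : 0 < T * T * (3 / 4 * X ^ 2) := by positivity
  nlinarith [sq_nonneg R]

/-- An anchored extragradient method for a strongly monotone inclusion with modulus `γ⁻¹`, begun with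
a forward-backward step from `um`, reaches after `T ≥ 14 / ζ` steps a point whose residual `g` satisfies
`γ ‖g‖ ≤ ‖u - um‖`. -/
theorem anchored_residual_le {E : Type*} [NormedAddCommGroup E] [InnerProductSpace ℝ E] (A : E → E)
    (u b w : ℕ → E) (um us : E) {γ ζ ℓ : ℝ} (T : ℕ) (hγ : 0 < γ) (hζ : 0 < ζ) (hζ' : ζ ≤ 1 / 4)
    (hT : 14 ≤ T * ζ) (hℓ : ζ * γ * ℓ ≤ 0.3)
    (hhalf : ∀ t < T, w t = u t + beta t • (u 0 - u t) - (ζ * γ) • (A (u t) + b t))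
    (hfull : ∀ t < T, u (t + 1) = u t + beta t • (u 0 - u t) - (ζ * γ) • (A (w t) + b (t + 1)))
    (hmono : ∀ t < T, 0 ≤ inner ℝ (A (u (t + 1)) + b (t + 1) - (A (u t) + b t)) (u (t + 1) - u t))
    (hlip : ∀ t < T, ‖A (u (t + 1)) - A (w t)‖ ≤ ℓ * ‖u (t + 1) - w t‖)
    (hzero : γ⁻¹ * ‖u T - us‖ ^ 2 ≤ inner ℝ (A (u T) + b T) (u T - us))
    (hstart : u 0 = um - (ζ * γ) • (A um + b 0))
    (hlip0 : ‖A (u 0) - A um‖ ≤ ℓ * ‖u 0 - um‖)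
    (hdist0 : ‖u 0 - us‖ ≤ 1.05 * ‖um - us‖) :
    γ * ‖A (u T) + b T‖ ≤ ‖u T - um‖ := by
  set c := ζ * γ with hc
  have hc0 : 0 < c := mul_pos hζ hγ
  set g : ℕ → E := fun t => c • (A (u t) + b t) with hg
  -- `g t - a` is the difference of the next iterate and the half step, and `g (t + 1) - a` is the
  -- step size times the difference of the values of `A` there
  have hdecr : ∀ t ≤ T, anchorPotential (u 0) t (g t) (u t) ≤ anchorPotential (u 0) 0 (g 0) (u 0) := by
    intro t
    induction t with
    | zero => intro _; exact le_rfl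
    | succ t ih =>
      intro ht
      refine le_trans ?_ (ih (by omega))
      refine anchorPotential_succ_le (a := c • (A (w t) + b (t + 1))) t (hfull t ht) ?_ ?_
      · rw [hg]
        simp only
        rw [← smul_sub, inner_smul_left]
        exact mul_nonneg (by simpa using hc0.le) (hmono t ht)
      · have e1 : g (t + 1) - c • (A (w t) + b (t + 1)) = c • (A (u (t + 1)) - A (w t)) := by
          rw [hg]; module
        have e2 : g t - c • (A (w t) + b (t + 1)) = u (t + 1) - w t := by
          rw [hfull t ht, hhalf t ht, hg]; module
        rw [e1, e2, norm_smul, Real.norm_of_nonneg hc0.le]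
        have h1 := mul_le_mul_of_nonneg_left (hlip t ht) hc0.le
        have h2 : c * ‖A (u (t + 1)) - A (w t)‖ ≤ 0.3 * ‖u (t + 1) - w t‖ := by
          nlinarith [norm_nonneg (u (t + 1) - w t)]
        have h3 := pow_le_pow_left₀ (by positivity) h2 2
        nlinarith [sq_nonneg ‖u (t + 1) - w t‖]
  have hR : 0 ≤ ‖um - us‖ := norm_nonneg _
  have hX₀ : ‖g 0‖ ≤ 1.3 * (‖um - us‖ + ‖u 0 - us‖) := by
    have e : g 0 = (um - u 0) + c • (A (u 0) - A um) := by
      have : c • (A um + b 0) = um - u 0 := by rw [hstart]; abel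
      rw [← this, hg]; module
    have h1 : ‖g 0‖ ≤ ‖um - u 0‖ + c * ‖A (u 0) - A um‖ := by
      rw [e]
      refine (norm_add_le _ _).trans_eq ?_
      rw [norm_smul, Real.norm_of_nonneg hc0.le]
    have h2 := mul_le_mul_of_nonneg_left hlip0 hc0.le
    rw [norm_sub_rev (u 0) um] at h2
    have h3 : ‖um - u 0‖ ≤ ‖um - us‖ + ‖u 0 - us‖ := by
      rw [norm_sub_rev (u 0) us]
      exact norm_sub_le_norm_sub_add_norm_sub _ _ _
    nlinarith [norm_nonneg (um - u 0)]
  have hin : -(‖g T‖ * ‖u 0 - us‖) ≤ inner ℝ (g T) (u T - u 0) := by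
    have e : u T - u 0 = (u T - us) - (u 0 - us) := by abel
    rw [e, inner_sub_right]
    have h1 : 0 ≤ inner ℝ (g T) (u T - us) := by
      rw [hg, inner_smul_left]
      refine mul_nonneg (by simpa using hc0.le) (le_trans (by positivity) hzero)
    linarith [real_inner_le_norm (g T) (u 0 - us)]
  have hpot := hdecr T le_rfl
  have hres : ‖g T‖ ≤ ζ * ‖um - us‖ / 2 := by
    refine residual_le_of_potential (T := T) (X₀ := ‖g 0‖) (R₀ := ‖u 0 - us‖) hζ hζ' hT
      (norm_nonneg _) (norm_nonneg _) hR hdist0 hX₀ ?_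
    rw [anchorPotential, anchorPotential, sub_self, inner_zero_right] at hpot
    have h1 := mul_le_mul_of_nonneg_left hin (by positivity : 0 ≤ ((T : ℝ) + 1) * (T + 2))
    push_cast at hpot
    nlinarith
  have hres' : γ * ‖A (u T) + b T‖ ≤ ‖um - us‖ / 2 := by
    rw [hg, norm_smul, Real.norm_of_nonneg hc0.le, hc] at hres
    have : ζ * (γ * ‖A (u T) + b T‖) ≤ ζ * (‖um - us‖ / 2) := by linarith
    exact le_of_mul_le_mul_left this hζ
  have hclose : ‖u T - us‖ ≤ γ * ‖A (u T) + b T‖ := by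
    have h1 := hzero.trans (real_inner_le_norm _ _)
    rw [inv_mul_le_iff₀ hγ] at h1
    by_contra! hlt
    nlinarith [norm_nonneg (u T - us), norm_nonneg (A (u T) + b T),
      mul_nonneg hγ.le (norm_nonneg (A (u T) + b T))]
  have htri : ‖um - us‖ ≤ ‖u T - um‖ + ‖u T - us‖ := by
    rw [norm_sub_rev (u T) um]
    exact norm_sub_le_norm_sub_add_norm_sub _ _ _
  linarith

/-! ### One step of the accelerated proximal point method -/

section

variable {E F : Type*} [NormedAddCommGroup E] [InnerProductSpace ℝ E] [NormedAddCommGroup F]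
  [InnerProductSpace ℝ F]

/-- The stopping test of the inner loop makes the gradient `(gz, gy)` at the new point point back to the
extrapolated point; `(rz, ry)` is the difference of the new and the extrapolated point. -/
theorem inner_le_of_accuracy {σ : ℝ} (hσ : 0 < σ) {rz gz : E} {ry gy : F}
    (h : (8 * σ⁻¹) * ‖(1 / 2 : ℝ) • (rz + σ • gz)‖ ^ 2 + (8 * σ⁻¹) * ‖gy + (σ / 8) • ry‖ ^ 2
      ≤ (8 * σ⁻¹)⁻¹ * ‖gz - σ⁻¹ • rz‖ ^ 2 + (8 * σ⁻¹)⁻¹ * ‖ry‖ ^ 2) :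
    0.6 * σ * ‖gz‖ ^ 2 + 4 / σ * ‖gy‖ ^ 2 ≤ -inner ℝ gz rz - inner ℝ gy ry := by
  -- the square that is left over after minimizing over `rz`
  have h0 : 0 ≤ 15 / 16 * σ⁻¹ * ‖rz + (3 / 5 * σ) • gz‖ ^ 2 := by positivity
  have h1 : (8 * σ⁻¹)⁻¹ * ‖gz - σ⁻¹ • rz‖ ^ 2 + (8 * σ⁻¹)⁻¹ * ‖ry‖ ^ 2 -
      ((8 * σ⁻¹) * ‖(1 / 2 : ℝ) • (rz + σ • gz)‖ ^ 2 + (8 * σ⁻¹) * ‖gy + (σ / 8) • ry‖ ^ 2)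
      = 2 * (-inner ℝ gz rz - inner ℝ gy ry - (0.6 * σ * ‖gz‖ ^ 2 + 4 / σ * ‖gy‖ ^ 2)
        - 15 / 16 * σ⁻¹ * ‖rz + (3 / 5 * σ) • gz‖ ^ 2) := by
    simp only [← real_inner_self_eq_norm_sq, inner_sub_left, inner_sub_right, inner_add_left,
      inner_add_right, inner_smul_left, inner_smul_right, conj_trivial]
    rw [real_inner_comm gz rz, real_inner_comm gy ry]
    field_simp
    ring
  linarith

/-- The change of the distance to `zs` in one step, in one of the two variables. -/
theorem norm_step_sq_le {η μ : ℝ} (hη : 0 < η) (hμ : 0 ≤ μ) (hs : η * μ ≤ 1 / 2) {z z' zf zs g : E}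
    (hz' : z' = z + (η * μ) • (zf - z) - η • g) :
    η⁻¹ * ‖z' - zs‖ ^ 2 ≤ (1 - η * μ) * (η⁻¹ * ‖z - zs‖ ^ 2) + μ * ‖zs - zf‖ ^ 2
      + 2 * inner ℝ g (zs - zf) - 2 * inner ℝ g (z - zf) + 2 * η * ‖g‖ ^ 2 := by
  have key : (1 - η * μ) * (η⁻¹ * ‖z - zs‖ ^ 2) + μ * ‖zs - zf‖ ^ 2
      + 2 * inner ℝ g (zs - zf) - 2 * inner ℝ g (z - zf) + 2 * η * ‖g‖ ^ 2
      - η⁻¹ * ‖z' - zs‖ ^ 2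
      = η⁻¹ * ‖η • g - (η * μ) • (z - zf)‖ ^ 2 + μ * (1 - 2 * (η * μ)) * ‖z - zf‖ ^ 2 := by
    have e1 : z' - zs = (z - zf) - (η * μ) • (z - zf) + (zf - zs) - η • g := by rw [hz']; module
    have e2 : z - zs = (z - zf) + (zf - zs) := by abel
    have e3 : zs - zf = -(zf - zs) := by abel
    rw [e1, e2, e3]
    simp only [← real_inner_self_eq_norm_sq]
    generalize z - zf = d
    generalize zf - zs = e
    simp only [inner_sub_left, inner_sub_right, inner_add_left, inner_neg_left, inner_neg_right,
      inner_add_right, inner_smul_left, inner_smul_right, conj_trivial]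
    rw [real_inner_comm d g, real_inner_comm e g, real_inner_comm d e]
    field_simp
    ring
  have h1 : 0 ≤ η⁻¹ * ‖η • g - (η * μ) • (z - zf)‖ ^ 2 := by positivity
  have h2 : 0 ≤ μ * (1 - 2 * (η * μ)) * ‖z - zf‖ ^ 2 :=
    mul_nonneg (mul_nonneg hμ (by linarith)) (sq_nonneg _)
  linarith

/-- The contraction of the potential in one step of the accelerated inexact proximal point method for
a function with the strong convexity moduli `μz`, `μy`; its values at the previous and the new
auxiliary point and at the minimizer are `P₀`, `P₁` and `Ps`. -/
theorem potential_contraction {a σ ηz ηy μz μy : ℝ} (ha : 0 < a) (ha1 : a ≤ 1)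
    (hηz : 0 < ηz) (hηy : 0 < ηy) (hμz : 0 ≤ μz) (hμy : 0 ≤ μy)
    (hsz : ηz * μz ≤ 1 / 2) (hsy : ηy * μy ≤ 1 / 2) (haz : a / 2 ≤ ηz * μz)
    (hay : a / 2 ≤ ηy * μy) (hηzσ : 2 * ηz * a ≤ 1.2 * σ) (hηyσ : 2 * ηy * a ≤ 8 / σ)
    {z z' zf zf₀ zs gz : E} {y y' yf yf₀ ys gy : F} {P₀ P₁ Ps : ℝ}
    (hz' : z' = z + (ηz * μz) • (zf - z) - ηz • gz) (hy' : y' = y + (ηy * μy) • (yf - y) - ηy • gy)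
    (hacc : 0.6 * σ * ‖gz‖ ^ 2 + 4 / σ * ‖gy‖ ^ 2
      ≤ -inner ℝ gz (zf - (a • z + (1 - a) • zf₀)) - inner ℝ gy (yf - (a • y + (1 - a) • yf₀)))
    (hP₀ : P₁ + inner ℝ gz (zf₀ - zf) + inner ℝ gy (yf₀ - yf) ≤ P₀)
    (hPs : P₁ + inner ℝ gz (zs - zf) + inner ℝ gy (ys - yf) + μz / 2 * ‖zs - zf‖ ^ 2
      + μy / 2 * ‖ys - yf‖ ^ 2 ≤ Ps) (hP : Ps ≤ P₀) :
    ηz⁻¹ * ‖z' - zs‖ ^ 2 + ηy⁻¹ * ‖y' - ys‖ ^ 2 + 2 * a⁻¹ * (P₁ - Ps)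
      ≤ (1 - a / 2) * (ηz⁻¹ * ‖z - zs‖ ^ 2 + ηy⁻¹ * ‖y - ys‖ ^ 2 + 2 * a⁻¹ * (P₀ - Ps)) := by
  have h1 := norm_step_sq_le (zs := zs) hηz hμz hsz hz'
  have h2 := norm_step_sq_le (zs := ys) hηy hμy hsy hy'
  have ez : -inner ℝ gz (zf - (a • z + (1 - a) • zf₀))
      = a * inner ℝ gz (z - zf) + (1 - a) * inner ℝ gz (zf₀ - zf) := by
    have : zf - (a • z + (1 - a) • zf₀) = -(a • (z - zf) + (1 - a) • (zf₀ - zf)) := by module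
    rw [this, inner_neg_right, inner_add_right, inner_smul_right, inner_smul_right, neg_neg]
  have ey : inner ℝ gy (yf - (a • y + (1 - a) • yf₀))
      = -(a * inner ℝ gy (y - yf) + (1 - a) * inner ℝ gy (yf₀ - yf)) := by
    have : yf - (a • y + (1 - a) • yf₀) = -(a • (y - yf) + (1 - a) • (yf₀ - yf)) := by module
    rw [this, inner_neg_right, inner_add_right, inner_smul_right, inner_smul_right]
  rw [ez, ey] at hacc
  have h3 : (1 - ηz * μz) * (ηz⁻¹ * ‖z - zs‖ ^ 2) ≤ (1 - a / 2) * (ηz⁻¹ * ‖z - zs‖ ^ 2) :=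
    mul_le_mul_of_nonneg_right (by linarith) (by positivity)
  have h4 : (1 - ηy * μy) * (ηy⁻¹ * ‖y - ys‖ ^ 2) ≤ (1 - a / 2) * (ηy⁻¹ * ‖y - ys‖ ^ 2) :=
    mul_le_mul_of_nonneg_right (by linarith) (by positivity)
  have h5 : a * (2 * ηz * ‖gz‖ ^ 2) ≤ 1.2 * σ * ‖gz‖ ^ 2 := by
    nlinarith [sq_nonneg ‖gz‖]
  have h6 : a * (2 * ηy * ‖gy‖ ^ 2) ≤ 8 / σ * ‖gy‖ ^ 2 := by
    nlinarith [mul_le_mul_of_nonneg_right hηyσ (sq_nonneg ‖gy‖)]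
  have h7 : (1 - a) * (P₁ + inner ℝ gz (zf₀ - zf) + inner ℝ gy (yf₀ - yf)) ≤ (1 - a) * P₀ :=
    mul_le_mul_of_nonneg_left hP₀ (by linarith)
  -- all remaining terms, multiplied by `a`
  have h8 : a * (2 * ηz * ‖gz‖ ^ 2 + 2 * ηy * ‖gy‖ ^ 2 - 2 * inner ℝ gz (z - zf)
      - 2 * inner ℝ gy (y - yf)) ≤ 2 * (1 - a) * (P₀ - P₁) := by
    have e : 4 / σ * ‖gy‖ ^ 2 = (8 / σ * ‖gy‖ ^ 2) / 2 := by ring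
    rw [e] at hacc
    linarith
  have h9 : 2 * ηz * ‖gz‖ ^ 2 + 2 * ηy * ‖gy‖ ^ 2 - 2 * inner ℝ gz (z - zf)
      - 2 * inner ℝ gy (y - yf) ≤ a⁻¹ * (2 * (1 - a) * (P₀ - P₁)) := by
    rwa [← div_eq_inv_mul, le_div_iff₀ ha, mul_comm]
  have h10 : a⁻¹ * (2 * (1 - a) * (P₀ - P₁)) + 2 * (Ps - P₁) + 2 * a⁻¹ * (P₁ - Ps)
      ≤ (1 - a / 2) * (2 * a⁻¹ * (P₀ - Ps)) := by
    have e : (1 - a / 2) * (2 * a⁻¹ * (P₀ - Ps)) - (a⁻¹ * (2 * (1 - a) * (P₀ - P₁))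
        + 2 * (Ps - P₁) + 2 * a⁻¹ * (P₁ - Ps)) = P₀ - Ps := by
      field_simp
      ring
    linarith
  linarith

end

/-! ### The constants -/

section

variable {σx σy : ℝ}

theorem alpha_pos (hx : 0 < σx) (hy : 0 < σy) : 0 < alpha σx σy :=
  lt_min one_pos (Real.sqrt_pos.2 (by positivity))

theorem alpha_le_one : alpha σx σy ≤ 1 := min_le_left _ _

theorem alpha_sq_le (hx : 0 < σx) (hy : 0 < σy) : alpha σx σy ^ 2 * σx ≤ 8 * σy := by
  have h1 : alpha σx σy ^ 2 ≤ 8 * σy / σx := by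
    rw [← Real.sq_sqrt (by positivity : 0 ≤ 8 * σy / σx)]
    exact pow_le_pow_left₀ (alpha_pos hx hy).le (min_le_right _ _) 2
  rwa [le_div_iff₀ hx] at h1

theorem etaY_pos (hx : 0 < σx) (hy : 0 < σy) : 0 < etaY σx σy := by
  have := alpha_pos hx hy
  exact lt_min (by positivity) (by positivity)

theorem etaY_mul_le (hy : 0 < σy) : etaY σx σy * σy ≤ 1 / 2 := by
  have h : etaY σx σy ≤ 1 / (2 * σy) := min_le_left _ _
  rw [le_div_iff₀ (by positivity)] at h
  linarith

theorem le_etaY_mul (hx : 0 < σx) (hy : 0 < σy) : alpha σx σy / 2 ≤ etaY σx σy * σy := by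
  have h0 := alpha_pos hx hy
  have h1 : alpha σx σy / 2 / σy ≤ etaY σx σy := by
    refine le_min ?_ ?_
    · rw [div_div, div_le_div_iff_of_pos_right (by positivity)]
      exact alpha_le_one
    · rw [div_div, div_le_div_iff₀ (by positivity) (by positivity)]
      have := alpha_sq_le hx hy
      nlinarith
  rwa [div_le_iff₀ hy] at h1

theorem etaY_alpha_le (hx : 0 < σx) (hy : 0 < σy) : 2 * etaY σx σy * alpha σx σy ≤ 8 / σx := by
  have h0 := alpha_pos hx hy
  have h : etaY σx σy ≤ 4 / (alpha σx σy * σx) := min_le_right _ _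
  rw [le_div_iff₀ (by positivity)] at h
  rw [le_div_iff₀ hx]
  linarith

theorem inv_etaY (hx : 0 < σx) (hy : 0 < σy) :
    (etaY σx σy)⁻¹ = max (2 * σy) (alpha σx σy * σx / 4) := by
  have h0 := alpha_pos hx hy
  rw [etaY]
  rcases le_total (1 / (2 * σy)) (4 / (alpha σx σy * σx)) with h | h
  · have h' := one_div_le_one_div_of_le (by positivity) h
    rw [one_div_one_div, one_div_div] at h'
    rw [min_eq_left h, max_eq_left h']
    simp
  · have h' := one_div_le_one_div_of_le (by positivity) h
    rw [one_div_one_div, one_div_div] at h'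
    rw [min_eq_right h, max_eq_right h', inv_div]

/-- The first factor of the iteration bound is the reciprocal of the contraction rate. -/
theorem rate_eq (hx : 0 < σx) (hy : 0 < σy) :
    max (2 / alpha σx σy) (alpha σx σy * σx / (4 * σy)) = 2 / alpha σx σy := by
  have h0 := alpha_pos hx hy
  refine max_eq_left ?_
  rw [div_le_div_iff₀ (by positivity) h0]
  have := alpha_sq_le hx hy
  nlinarith

theorem rate_eq_sqrt (hx : 0 < σx) (hy : 0 < σy) :
    max 2 √(σx / (2 * σy)) = 2 / alpha σx σy := by
  have hs : 0 < √(8 * σy / σx) := Real.sqrt_pos.2 (by positivity)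
  have h : √(σx / (2 * σy)) = 2 / √(8 * σy / σx) := by
    rw [eq_div_iff hs.ne', ← Real.sqrt_mul (by positivity)]
    have : σx / (2 * σy) * (8 * σy / σx) = 2 ^ 2 := by field_simp; norm_num
    rw [this, Real.sqrt_sq (by norm_num)]
  rw [h, alpha]
  rcases le_total 1 √(8 * σy / σx) with h1 | h1
  · rw [min_eq_left h1, div_one]
    exact max_eq_left ((div_le_iff₀ hs).2 (by linarith))
  · rw [min_eq_right h1]
    exact max_eq_right ((le_div_iff₀ hs).2 (by linarith))

end

namespace Input

/-! ### The saddle point -/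

/-- The assumptions on the functions and constants of the problem. -/
structure Assumptions (I : Input n m) (U : Set (Vec n)) (V : Set (Vec m)) : Prop where
  convex_p : ProperClosedConvex I.p
  convex_q : ProperClosedConvex I.q
  compact_p : IsCompact (dom I.p)
  compact_q : IsCompact (dom I.q)
  σx_pos : 0 < I.σx
  σy_pos : 0 < I.σy
  L_pos : 0 < I.L
  ε_pos : 0 < I.ε
  dom_p_sub : dom I.p ⊆ U
  dom_q_sub : dom I.q ⊆ V
  convex : StronglyConvexConcaveOn I.h I.σx I.σy U V
  smooth : SmoothOn I.h I.L (box U V)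

/-- `(x, y)` satisfies the first-order conditions `-∇_x h(x, y) ∈ ∂ p(x)` and
`∇_y h(x, y) ∈ ∂ q(y)` for a saddle point. -/
def IsSaddle (I : Input n m) (x : Vec n) (y : Vec m) : Prop :=
  IsSubgradPair I.p I.q (pair x y) (-saddleOp I.h (pair x y))

variable {I : Input n m} {U : Set (Vec n)} {V : Set (Vec m)}

theorem Assumptions.dom_box_sub (hI : I.Assumptions U V) :
    box (dom I.p) (dom I.q) ⊆ box U V :=
  fun _ hw => ⟨hI.dom_p_sub hw.1, hI.dom_q_sub hw.2⟩

theorem Assumptions.exists_isSaddle (hI : I.Assumptions U V) : ∃ x y, I.IsSaddle x y := by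
  obtain ⟨w, hw⟩ := exists_isSubgradPair_neg hI.convex_p hI.convex_q hI.compact_p hI.compact_q
    (saddleOp I.h) (lt_min hI.σx_pos hI.σy_pos) hI.L_pos
    (fun w hw w' hw' => by
      refine le_trans ?_ (saddleOp_monotone hI.convex hI.smooth (hI.dom_box_sub hw)
        (hI.dom_box_sub hw'))
      rw [norm_sq_pt, mul_add]
      exact add_le_add (mul_le_mul_of_nonneg_right (min_le_left _ _) (sq_nonneg _))
        (mul_le_mul_of_nonneg_right (min_le_right _ _) (sq_nonneg _)))
    (fun w hw w' hw' => saddleOp_lipschitz hI.smooth (hI.dom_box_sub hw) (hI.dom_box_sub hw'))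
  exact ⟨w.fst, w.snd, hw⟩

theorem Assumptions.H_eq (hI : I.Assumptions U V) {x : Vec n} {y : Vec m} (hx : x ∈ dom I.p)
    (hy : y ∈ dom I.q) :
    I.H x y = ((I.h (pair x y) + (I.p x).toReal - (I.q y).toReal : ℝ) : EReal) := by
  rw [H, EReal.coe_sub, EReal.coe_add, hI.convex_p.coe_toReal hx, hI.convex_q.coe_toReal hy]

theorem H_eq_bot (x : Vec n) {y : Vec m} (hy : y ∉ dom I.q) : I.H x y = ⊥ := by
  have : I.q y = ⊤ := by simpa [dom] using hy
  rw [H, this, EReal.sub_top]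

theorem Assumptions.H_eq_top (hI : I.Assumptions U V) {x : Vec n} {y : Vec m} (hx : x ∉ dom I.p)
    (hy : y ∈ dom I.q) : I.H x y = ⊤ := by
  have : I.p x = ⊤ := by simpa [dom] using hx
  rw [H, this, EReal.coe_add_top, ← hI.convex_q.coe_toReal hy, EReal.top_sub_coe]

theorem IsSaddle.mem_p {x : Vec n} {y : Vec m} (h : I.IsSaddle x y) : x ∈ dom I.p := h.1.1

theorem IsSaddle.mem_q {x : Vec n} {y : Vec m} (h : I.IsSaddle x y) : y ∈ dom I.q := h.2.1

theorem IsSaddle.le_fst (hI : I.Assumptions U V) {xs : Vec n} {ys : Vec m} (h : I.IsSaddle xs ys)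
    {x : Vec n} (hx : x ∈ dom I.p) :
    I.h (pair xs ys) + (I.p xs).toReal + I.σx / 2 * ‖x - xs‖ ^ 2
      ≤ I.h (pair x ys) + (I.p x).toReal := by
  have h1 := hI.convex.firstOrder_fst (hI.dom_p_sub h.mem_p) (hI.dom_p_sub hx)
    (hI.dom_q_sub h.mem_q) (hI.smooth.1 _ (hI.dom_box_sub ⟨h.mem_p, h.mem_q⟩))
  have h2 : _ + inner ℝ (-(gradient I.h (pair xs ys)).fst) (x - xs) ≤ _ := h.1.2 x hx
  rw [inner_neg_left] at h2
  rw [pair_fst] at h2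
  linarith

theorem IsSaddle.le_snd (hI : I.Assumptions U V) {xs : Vec n} {ys : Vec m} (h : I.IsSaddle xs ys)
    {y : Vec m} (hy : y ∈ dom I.q) :
    I.h (pair xs y) - (I.q y).toReal + I.σy / 2 * ‖y - ys‖ ^ 2
      ≤ I.h (pair xs ys) - (I.q ys).toReal := by
  have h1 := hI.convex.firstOrder_snd (hI.dom_p_sub h.mem_p) (hI.dom_q_sub h.mem_q)
    (hI.dom_q_sub hy) (hI.smooth.1 _ (hI.dom_box_sub ⟨h.mem_p, h.mem_q⟩))
  have h2 : _ + inner ℝ (- -(gradient I.h (pair xs ys)).snd) (y - ys) ≤ _ := h.2.2 y hy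
  rw [neg_neg] at h2
  rw [pair_snd] at h2
  linarith

theorem IsSaddle.iSup_H (hI : I.Assumptions U V) {xs : Vec n} {ys : Vec m}
    (h : I.IsSaddle xs ys) : ⨆ y, I.H xs y = I.H xs ys := by
  refine le_antisymm (iSup_le fun y => ?_) (le_iSup (fun y => I.H xs y) ys)
  by_cases hy : y ∈ dom I.q
  · rw [hI.H_eq h.mem_p hy, hI.H_eq h.mem_p h.mem_q, EReal.coe_le_coe_iff]
    have := h.le_snd hI hy
    have h2 : 0 ≤ I.σy / 2 * ‖y - ys‖ ^ 2 := mul_nonneg (by linarith [hI.σy_pos]) (sq_nonneg _)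
    linarith
  · rw [H_eq_bot xs hy]
    exact bot_le

theorem IsSaddle.H_le (hI : I.Assumptions U V) {xs : Vec n} {ys : Vec m}
    (h : I.IsSaddle xs ys) (x : Vec n) : I.H xs ys ≤ I.H x ys := by
  by_cases hx : x ∈ dom I.p
  · rw [hI.H_eq h.mem_p h.mem_q, hI.H_eq hx h.mem_q, EReal.coe_le_coe_iff]
    have := h.le_fst hI hx
    have h2 : 0 ≤ I.σx / 2 * ‖x - xs‖ ^ 2 := mul_nonneg (by linarith [hI.σx_pos]) (sq_nonneg _)
    linarith
  · rw [hI.H_eq_top hx h.mem_q]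
    exact le_top

theorem IsSaddle.isOptimal (hI : I.Assumptions U V) {xs : Vec n} {ys : Vec m}
    (h : I.IsSaddle xs ys) : I.IsOptimal xs ys := by
  refine ⟨fun x => ?_, fun y => ?_⟩
  · rw [h.iSup_H hI]
    exact (h.H_le hI x).trans (le_iSup (fun y => I.H x y) ys)
  · rw [← h.iSup_H hI]
    exact le_iSup (fun y => I.H xs y) y

theorem IsSaddle.Hstar_eq (hI : I.Assumptions U V) {xs : Vec n} {ys : Vec m}
    (h : I.IsSaddle xs ys) : I.Hstar = I.H xs ys := by
  refine le_antisymm ?_ (le_iInf fun x => ?_)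
  · rw [← h.iSup_H hI]
    exact iInf_le (fun x => ⨆ y, I.H x y) xs
  · rw [← h.iSup_H hI]
    exact (h.isOptimal hI).1 x

theorem eq_of_add_sq_norm_le {E : Type*} [NormedAddCommGroup E] {x y : E} {σ a b : ℝ} (hσ : 0 < σ)
    (h1 : a + σ / 2 * ‖x - y‖ ^ 2 ≤ b) (h2 : b ≤ a) : x = y := by
  have h3 : ‖x - y‖ ^ 2 ≤ 0 := by
    by_contra! hcon
    have : 0 < σ / 2 * ‖x - y‖ ^ 2 := by positivity
    linarith
  exact sub_eq_zero.1 (norm_eq_zero.1 (pow_eq_zero_iff two_ne_zero |>.1 (le_antisymm h3 (sq_nonneg _))))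

theorem IsSaddle.eq_of_isOptimal (hI : I.Assumptions U V) {xs : Vec n} {ys : Vec m}
    (h : I.IsSaddle xs ys) {x : Vec n} {y : Vec m} (ho : I.IsOptimal x y) : x = xs ∧ y = ys := by
  have h1 : I.H x ys ≤ I.H xs ys := by
    rw [← h.iSup_H hI]
    exact (le_iSup (fun y => I.H x y) ys).trans (ho.1 xs)
  have hx : x ∈ dom I.p := by
    by_contra hx
    rw [hI.H_eq_top hx h.mem_q, hI.H_eq h.mem_p h.mem_q, top_le_iff] at h1
    exact EReal.coe_ne_top _ h1
  have hxs : x = xs := by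
    rw [hI.H_eq hx h.mem_q, hI.H_eq h.mem_p h.mem_q, EReal.coe_le_coe_iff] at h1
    exact eq_of_add_sq_norm_le hI.σx_pos (h.le_fst hI hx) (by linarith)
  subst hxs
  refine ⟨rfl, ?_⟩
  have h2 := ho.2 ys
  have hy : y ∈ dom I.q := by
    by_contra hy
    rw [H_eq_bot x hy, hI.H_eq hx h.mem_q, le_bot_iff] at h2
    exact EReal.coe_ne_bot _ h2
  rw [hI.H_eq hx hy, hI.H_eq hx h.mem_q, EReal.coe_le_coe_iff] at h2
  exact eq_of_add_sq_norm_le hI.σy_pos (h.le_snd hI hy) (by linarith)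

/-! ### The dual-primal potential -/

theorem Assumptions.hHat_fst (hI : I.Assumptions U V) {x x' : Vec n} {y : Vec m} (hx : x ∈ U)
    (hx' : x' ∈ U) (hy : y ∈ V) :
    I.hHat x y + inner ℝ (I.gxHat x y) (x' - x) ≤ I.hHat x' y := by
  have h1 := hI.convex.firstOrder_fst hx hx' hy (hI.smooth.1 _ ⟨hx, hy⟩)
  rw [hHat, hHat, gxHat, gx, inner_sub_left, inner_smul_left]
  have h2 : ‖x' - x‖ ^ 2 = ‖x'‖ ^ 2 - ‖x‖ ^ 2 - 2 * inner ℝ x (x' - x) := by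
    rw [norm_sub_sq_real, inner_sub_right, real_inner_self_eq_norm_sq, real_inner_comm]
    ring
  rw [h2] at h1
  simp only [conj_trivial]
  linarith

theorem Assumptions.hHat_snd (hI : I.Assumptions U V) {x : Vec n} {y y' : Vec m} (hx : x ∈ U)
    (hy : y ∈ V) (hy' : y' ∈ V) :
    I.hHat x y' ≤ I.hHat x y + inner ℝ (I.gyHat x y) (y' - y) := by
  have h1 := hI.convex.firstOrder_snd hx hy hy' (hI.smooth.1 _ ⟨hx, hy⟩)
  rw [hHat, hHat, gyHat, gy, inner_add_left, inner_smul_left]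
  have h2 : ‖y' - y‖ ^ 2 = ‖y'‖ ^ 2 - ‖y‖ ^ 2 - 2 * inner ℝ y (y' - y) := by
    rw [norm_sub_sq_real, inner_sub_right, real_inner_self_eq_norm_sq, real_inner_comm]
    ring
  rw [h2] at h1
  simp only [conj_trivial]
  linarith

theorem Assumptions.G_term_eq (hI : I.Assumptions U V) {x : Vec n} {y : Vec m} (hx : x ∈ dom I.p)
    (hy : y ∈ dom I.q) (z : Vec n) :
    ((inner ℝ x z - I.hHat x y : ℝ) : EReal) - I.p x + I.q y
      = ((inner ℝ x z - I.hHat x y - (I.p x).toReal + (I.q y).toReal : ℝ) : EReal) := by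
  rw [EReal.coe_add, EReal.coe_sub (inner ℝ x z - I.hHat x y), hI.convex_p.coe_toReal hx,
    hI.convex_q.coe_toReal hy]

theorem Assumptions.le_G (hI : I.Assumptions U V) {x : Vec n} {y : Vec m} (hx : x ∈ dom I.p)
    (hy : y ∈ dom I.q) (z : Vec n) :
    ((inner ℝ x z - I.hHat x y - (I.p x).toReal + (I.q y).toReal : ℝ) : EReal) ≤ I.G z y := by
  rw [← hI.G_term_eq hx hy]
  exact le_iSup (fun x => ((inner ℝ x z - I.hHat x y : ℝ) : EReal) - I.p x + I.q y) x

theorem Assumptions.G_le (hI : I.Assumptions U V) {y : Vec m} (hy : y ∈ dom I.q) {z : Vec n} {M : ℝ}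
    (h : ∀ x ∈ dom I.p, inner ℝ x z - I.hHat x y - (I.p x).toReal + (I.q y).toReal ≤ M) :
    I.G z y ≤ M := by
  refine iSup_le fun x => ?_
  by_cases hx : x ∈ dom I.p
  · rw [hI.G_term_eq hx hy, EReal.coe_le_coe_iff]
    exact h x hx
  · have : I.p x = ⊤ := by simpa [dom] using hx
    rw [this, EReal.sub_top, EReal.bot_add]
    exact bot_le

theorem Assumptions.G_ne_bot (hI : I.Assumptions U V) {y : Vec m} (hy : y ∈ dom I.q) (z : Vec n) :
    I.G z y ≠ ⊥ := by
  obtain ⟨x, hx⟩ := hI.convex_p.proper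
  intro h
  have := hI.le_G hx hy z
  rw [h, le_bot_iff] at this
  exact EReal.coe_ne_bot _ this

theorem Assumptions.G_ne_top (hI : I.Assumptions U V) {y : Vec m} (hy : y ∈ dom I.q) (z : Vec n) :
    I.G z y ≠ ⊤ := by
  obtain ⟨x₀, s₀, hs⟩ := hI.convex_p.exists_isSubgrad hI.compact_p
  obtain ⟨B, hB⟩ := hI.compact_p.isBounded.exists_norm_le
  set v := z - I.gxHat x₀ y - s₀ with hv
  refine ne_top_of_le_ne_top (EReal.coe_ne_top _) (hI.G_le hy
    (M := B * ‖v‖ + inner ℝ (I.gxHat x₀ y + s₀) x₀ - I.hHat x₀ y - (I.p x₀).toReal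
      + (I.q y).toReal) fun x hx => ?_)
  have h1 := hI.hHat_fst (hI.dom_p_sub hs.1) (hI.dom_p_sub hx) (hI.dom_q_sub hy)
  have h2 := hs.2 x hx
  have h3 : inner ℝ x v ≤ B * ‖v‖ :=
    (real_inner_le_norm _ _).trans (mul_le_mul_of_nonneg_right (hB x hx) (norm_nonneg _))
  rw [hv, inner_sub_right, inner_sub_right, real_inner_comm (I.gxHat x₀ y) x,
    real_inner_comm s₀ x] at h3
  rw [← hv] at h3
  rw [inner_sub_right] at h1 h2
  rw [inner_add_left]
  linarith

theorem Assumptions.le_P (hI : I.Assumptions U V) {x : Vec n} {y : Vec m} (hx : x ∈ dom I.p)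
    (hy : y ∈ dom I.q) (z : Vec n) :
    I.σx⁻¹ * ‖z‖ ^ 2 / 2 + I.σy * ‖y‖ ^ 2 / 2
      + (inner ℝ x z - I.hHat x y - (I.p x).toReal + (I.q y).toReal) ≤ I.P z y := by
  have h := EReal.toReal_le_toReal (hI.le_G hx hy z) (EReal.coe_ne_bot _) (hI.G_ne_top hy z)
  rw [EReal.toReal_coe] at h
  rw [P]
  linarith

theorem Assumptions.P_le (hI : I.Assumptions U V) {y : Vec m} (hy : y ∈ dom I.q) {z : Vec n} {M : ℝ}
    (h : ∀ x ∈ dom I.p, inner ℝ x z - I.hHat x y - (I.p x).toReal + (I.q y).toReal ≤ M) :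
    I.P z y ≤ I.σx⁻¹ * ‖z‖ ^ 2 / 2 + I.σy * ‖y‖ ^ 2 / 2 + M := by
  have h := EReal.toReal_le_toReal (hI.G_le hy h) (hI.G_ne_bot hy z) (EReal.coe_ne_top _)
  rw [EReal.toReal_coe] at h
  rw [P]
  linarith

/-- The potential `P` is strongly convex. A pair of subgradients of `p` at `x` and of `q` at `y`
yields the point `(z, y)` at which the supremum in `G` is attained at `x`, and a subgradient of `P`
at `(z, y)`. -/
theorem Assumptions.P_strongConvex (hI : I.Assumptions U V) {x bx : Vec n} {y bY : Vec m}
    (hx : IsSubgrad I.p x bx) (hy : IsSubgrad I.q y bY) {z w : _} (hz : z = I.gxHat x y + bx)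
    (hw : w = -I.gyHat x y + bY) (z' : Vec n) {y' : Vec m} (hy' : y' ∈ dom I.q) :
    I.P z y + inner ℝ (x + I.σx⁻¹ • z) (z' - z) + inner ℝ (w + I.σy • y) (y' - y)
      + I.σx⁻¹ / 2 * ‖z' - z‖ ^ 2 + I.σy / 2 * ‖y' - y‖ ^ 2 ≤ I.P z' y' := by
  have hxU := hI.dom_p_sub hx.1
  have hyV := hI.dom_q_sub hy.1
  have h1 := hI.P_le hy.1 (z := z)
    (M := inner ℝ x z - I.hHat x y - (I.p x).toReal + (I.q y).toReal) (by
      intro x' hx'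
      have h1 := hI.hHat_fst hxU (hI.dom_p_sub hx') hyV
      have h2 := hx.2 x' hx'
      have h3 : inner ℝ x' z - inner ℝ x z = inner ℝ (I.gxHat x y) (x' - x)
          + inner ℝ bx (x' - x) := by
        rw [← inner_sub_left, ← inner_add_left, ← hz, real_inner_comm]
      linarith)
  have h2 := hI.le_P hx.1 hy' z'
  have h3 := hI.hHat_snd hxU hyV (hI.dom_q_sub hy')
  have h4 := hy.2 y' hy'
  have ez : I.σx⁻¹ * ‖z'‖ ^ 2 / 2 = I.σx⁻¹ * ‖z‖ ^ 2 / 2 + inner ℝ (I.σx⁻¹ • z) (z' - z)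
      + I.σx⁻¹ / 2 * ‖z' - z‖ ^ 2 := by
    rw [norm_sub_sq_real, inner_smul_left, inner_sub_right, real_inner_self_eq_norm_sq,
      real_inner_comm, conj_trivial]
    ring
  have ey : I.σy * ‖y'‖ ^ 2 / 2 = I.σy * ‖y‖ ^ 2 / 2 + inner ℝ (I.σy • y) (y' - y)
      + I.σy / 2 * ‖y' - y‖ ^ 2 := by
    rw [norm_sub_sq_real, inner_smul_left, inner_sub_right, real_inner_self_eq_norm_sq,
      real_inner_comm, conj_trivial]
    ring
  rw [ez, ey] at h2
  have e5 : inner ℝ w (y' - y) = -inner ℝ (I.gyHat x y) (y' - y) + inner ℝ bY (y' - y) := by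
    rw [hw, inner_add_left, inner_neg_left]
  rw [inner_add_left, inner_add_left, e5, inner_sub_right x]
  linarith

theorem IsSaddle.P_le (hI : I.Assumptions U V) {xs : Vec n} {ys : Vec m} (h : I.IsSaddle xs ys)
    (z : Vec n) {y : Vec m} (hy : y ∈ dom I.q) : I.P (-(I.σx • xs)) ys ≤ I.P z y := by
  have h1 := hI.P_strongConvex (x := xs) (bx := -I.gx xs ys) (y := ys) (bY := - -I.gy xs ys)
    h.1 h.2 (z := -(I.σx • xs)) (w := -(I.σy • ys)) (by rw [gxHat]; abel) (by rw [gyHat]; abel) z hy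
  have e : xs + I.σx⁻¹ • -(I.σx • xs) = 0 := by
    rw [smul_neg, inv_smul_smul₀ hI.σx_pos.ne', add_neg_cancel]
  rw [e, neg_add_cancel, inner_zero_left, inner_zero_left] at h1
  have h2 : 0 ≤ I.σx⁻¹ / 2 * ‖z - -(I.σx • xs)‖ ^ 2 := by
    have := hI.σx_pos
    positivity
  have h3 : 0 ≤ I.σy / 2 * ‖y - ys‖ ^ 2 := by
    have := hI.σy_pos
    positivity
  linarith

/-- The initial value of the potential, bounded by the diameters and the range of `H`. -/
theorem IsSaddle.theta0_le (hI : I.Assumptions U V) {xs : Vec n} {ys : Vec m}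
    (h : I.IsSaddle xs ys) {u : Vec n} (hu : u ∈ dom I.p) (hz0 : I.z0 = -(I.σx • u))
    (hy0 : I.y0 ∈ dom I.q) (hlow : I.Hlow ≠ ⊥) :
    I.theta0 xs ys ≤ I.deltaBar
      + 2 * (alpha I.σx I.σy)⁻¹ * (I.Hstar.toReal - I.Hlow.toReal) := by
  have hσ := hI.σx_pos
  have ha := alpha_pos hI.σx_pos hI.σy_pos
  set Dx := Metric.diam (dom I.p)
  set Dy := Metric.diam (dom I.q)
  have hdx : ∀ x ∈ dom I.p, ∀ x' ∈ dom I.p, ‖x - x'‖ ^ 2 ≤ Dx ^ 2 := fun x hx x' hx' => by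
    rw [← dist_eq_norm]
    exact pow_le_pow_left₀ dist_nonneg (Metric.dist_le_diam_of_mem hI.compact_p.isBounded hx hx') 2
  have hdy : ‖I.y0 - ys‖ ^ 2 ≤ Dy ^ 2 := by
    rw [← dist_eq_norm]
    exact pow_le_pow_left₀ dist_nonneg
      (Metric.dist_le_diam_of_mem hI.compact_q.isBounded hy0 h.mem_q) 2
  have hlow' : ∀ x ∈ dom I.p, I.Hlow.toReal
      ≤ I.h (pair x I.y0) + (I.p x).toReal - (I.q I.y0).toReal := fun x hx => by
    have h1 : I.Hlow ≤ I.H x I.y0 := (iInf₂_le x hx).trans (iInf₂_le I.y0 hy0)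
    rw [hI.H_eq hx hy0] at h1
    have h2 := EReal.toReal_le_toReal h1 hlow (EReal.coe_ne_top _)
    rwa [EReal.toReal_coe] at h2
  have hP0 : I.P I.z0 I.y0 ≤ I.σx * Dx ^ 2 / 2 - I.Hlow.toReal := by
    refine (hI.P_le hy0 (M := I.σx * Dx ^ 2 / 2 - I.Hlow.toReal - I.σx * ‖u‖ ^ 2 / 2
      - I.σy * ‖I.y0‖ ^ 2 / 2) fun x hx => ?_).trans_eq ?_
    · have h1 := hlow' x hx
      have h2 := mul_le_mul_of_nonneg_left (hdx x hx u hu) hσ.le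
      rw [norm_sub_sq_real] at h2
      rw [hz0, inner_neg_right, inner_smul_right, hHat]
      linarith
    · rw [hz0, norm_neg, norm_smul, Real.norm_of_nonneg hσ.le]
      field_simp
      ring
  have hPs : -I.Hstar.toReal ≤ I.P (-(I.σx • xs)) ys := by
    rw [h.Hstar_eq hI, hI.H_eq h.mem_p h.mem_q, EReal.toReal_coe]
    refine le_of_eq_of_le ?_ (hI.le_P h.mem_p h.mem_q _)
    rw [inner_neg_right, inner_smul_right, real_inner_self_eq_norm_sq, hHat, norm_neg, norm_smul,
      Real.norm_of_nonneg hσ.le]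
    field_simp
    ring
  have hz : (etaZ I.σx)⁻¹ * ‖I.z0 - -(I.σx • xs)‖ ^ 2 ≤ 2 * I.σx * Dx ^ 2 := by
    have e : I.z0 - -(I.σx • xs) = -(I.σx • (u - xs)) := by rw [hz0]; module
    rw [e, norm_neg, norm_smul, Real.norm_of_nonneg hσ.le, etaZ, mul_pow]
    have : (I.σx / 2)⁻¹ * (I.σx ^ 2 * ‖u - xs‖ ^ 2) = 2 * I.σx * ‖u - xs‖ ^ 2 := by
      field_simp
    rw [this]
    exact mul_le_mul_of_nonneg_left (hdx u hu xs h.mem_p) (by positivity)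
  have hy : (etaY I.σx I.σy)⁻¹ * ‖I.y0 - ys‖ ^ 2
      ≤ max (2 * I.σy) (alpha I.σx I.σy * I.σx / 4) * Dy ^ 2 := by
    rw [inv_etaY hI.σx_pos hI.σy_pos]
    exact mul_le_mul_of_nonneg_left hdy (le_max_of_le_left (by linarith [hI.σy_pos]))
  have hP : 2 * (alpha I.σx I.σy)⁻¹ * (I.P I.z0 I.y0 - I.P (-(I.σx • xs)) ys)
      ≤ 2 * (alpha I.σx I.σy)⁻¹ * (I.σx * Dx ^ 2 / 2 - I.Hlow.toReal + I.Hstar.toReal) :=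
    mul_le_mul_of_nonneg_left (by linarith) (by positivity)
  rw [theta0, deltaBar]
  linarith

/-! ### The inner loop -/

/-- The operator `(a_x, a_y)` of the subproblem solved by the inner loop. -/
noncomputable def innerOp (I : Input n m) (s : Outer n m) (w : Pt n m) : Pt n m :=
  pair (I.ax s w.fst w.snd) (I.ay s w.fst w.snd)

theorem innerOp_sub (s : Outer n m) (w w' : Pt n m) :
    I.innerOp s w - I.innerOp s w' = (saddleOp I.h w - saddleOp I.h w')
      + pair (-((I.σx / 2) • (w.fst - w'.fst))) ((I.σx / 8) • (w.snd - w'.snd)) := by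
  refine Pt.ext ?_ ?_
  · change I.ax s w.fst w.snd - I.ax s w'.fst w'.snd
      = ((gradient I.h w).fst - (gradient I.h w').fst) + -((I.σx / 2) • (w.fst - w'.fst))
    simp only [ax, gxHat, gx, pair_eta]
    module
  · change I.ay s w.fst w.snd - I.ay s w'.fst w'.snd
      = (-(gradient I.h w).snd - -(gradient I.h w').snd) + (I.σx / 8) • (w.snd - w'.snd)
    simp only [ay, gyHat, gy, pair_eta]
    module

theorem gam_pos (hI : I.Assumptions U V) : 0 < gam I.σx :=
  mul_pos (by norm_num) (inv_pos.2 hI.σx_pos)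

theorem inv_gam (σ : ℝ) : (gam σ)⁻¹ = σ / 8 := by
  rw [gam, mul_inv, inv_inv]
  ring

theorem innerOp_monotone (hI : I.Assumptions U V) (s : Outer n m) {w w' : Pt n m}
    (hw : w ∈ box U V) (hw' : w' ∈ box U V) :
    (gam I.σx)⁻¹ * ‖w - w'‖ ^ 2 ≤ inner ℝ (I.innerOp s w - I.innerOp s w') (w - w') := by
  have h := saddleOp_monotone hI.convex hI.smooth hw hw'
  rw [innerOp_sub, inner_add_left, inv_gam, norm_sq_pt, inner_pt (pair _ _)]
  simp only [pair_fst, pair_snd]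
  rw [WithLp.sub_fst, WithLp.sub_snd, inner_neg_left, inner_smul_left, inner_smul_left,
    real_inner_self_eq_norm_sq, real_inner_self_eq_norm_sq]
  simp only [conj_trivial]
  nlinarith [mul_nonneg hI.σx_pos.le (sq_nonneg ‖w.fst - w'.fst‖),
    mul_nonneg hI.σy_pos.le (sq_nonneg ‖w.snd - w'.snd‖)]

theorem lt_sqrt_five : (2.23 : ℝ) < √5 := by
  rw [Real.lt_sqrt (by norm_num)]
  norm_num

theorem one_add_ratio_pos (hI : I.Assumptions U V) : 0 < 1 + 8 * I.L / I.σx := by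
  have := hI.L_pos
  have := hI.σx_pos
  positivity

theorem zeta_pos (hI : I.Assumptions U V) : 0 < zeta I.σx I.L :=
  inv_pos.2 (mul_pos (by positivity) (one_add_ratio_pos hI))

theorem zeta_le (hI : I.Assumptions U V) : zeta I.σx I.L ≤ 1 / 4 := by
  have h1 := lt_sqrt_five
  have h2 : 0 < 8 * I.L / I.σx := by
    have := hI.L_pos
    have := hI.σx_pos
    positivity
  rw [zeta, ← one_div]
  refine one_div_le_one_div_of_le (by norm_num) ?_
  nlinarith

/-- The inner step size is small compared with the Lipschitz constant of the inner operator. Adding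
`-σx / 2` times the identity in `x` raises the constant `L` by at most half of itself, as `σx ≤ L`
unless there is only one `x`. -/
theorem exists_innerOp_lipschitz (hI : I.Assumptions U V) :
    ∃ ℓ, 0 < ℓ ∧ zeta I.σx I.L * gam I.σx * ℓ ≤ 0.3 ∧ ∀ s, ∀ w ∈ box U V, ∀ w' ∈ box U V,
      ‖I.innerOp s w - I.innerOp s w'‖ ≤ ℓ * ‖w - w'‖ := by
  have hσ := hI.σx_pos
  have hL := hI.L_pos
  have h5 := lt_sqrt_five
  have hκ := one_add_ratio_pos hI
  -- the Lipschitz constant is `L + c` if the linear part has norm at most `c`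
  have key : ∀ c, 0 ≤ c → (∀ w ∈ box U V, ∀ w' ∈ box U V,
      ‖pair (-((I.σx / 2) • (w.fst - w'.fst))) ((I.σx / 8) • (w.snd - w'.snd))‖ ^ 2
        ≤ (c * ‖w - w'‖) ^ 2) → ∀ s, ∀ w ∈ box U V, ∀ w' ∈ box U V,
      ‖I.innerOp s w - I.innerOp s w'‖ ≤ (I.L + c) * ‖w - w'‖ := by
    intro c hc h s w hw w' hw'
    rw [innerOp_sub, add_mul]
    refine (norm_add_le _ _).trans (add_le_add (saddleOp_lipschitz hI.smooth hw hw') ?_)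
    exact (sq_le_sq₀ (norm_nonneg _) (by positivity)).1 (h w hw w' hw')
  have hnorm : ∀ w w' : Pt n m,
      ‖pair (-((I.σx / 2) • (w.fst - w'.fst))) ((I.σx / 8) • (w.snd - w'.snd))‖ ^ 2
        = (I.σx / 2) ^ 2 * ‖w.fst - w'.fst‖ ^ 2 + (I.σx / 8) ^ 2 * ‖w.snd - w'.snd‖ ^ 2 := by
    intro w w'
    rw [norm_sq_pt]
    simp only [pair_fst, pair_snd]
    rw [norm_neg, norm_smul, norm_smul, mul_pow, mul_pow, Real.norm_of_nonneg (by positivity),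
      Real.norm_of_nonneg (by positivity)]
  have hstep : ∀ ℓ, zeta I.σx I.L * gam I.σx * ℓ
      = (8 * ℓ / I.σx) / (2 * √5 * (1 + 8 * I.L / I.σx)) := by
    intro ℓ
    rw [zeta, gam]
    field_simp
  rcases modulus_le_lipschitz hI.convex hI.smooth (hI.convex_q.proper.mono hI.dom_q_sub) with h | h
  · refine ⟨I.L + I.σx / 8, by positivity, ?_, key _ (by positivity) fun w hw w' hw' => ?_⟩
    · rw [hstep, div_le_iff₀ (by positivity)]
      have e : 8 * (I.L + I.σx / 8) / I.σx = 1 + 8 * I.L / I.σx := by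
        field_simp
        ring
      rw [e]
      nlinarith
    · rw [hnorm, h hw.1 hw'.1, sub_self, norm_zero, mul_pow, norm_sq_pt]
      rw [WithLp.sub_fst, WithLp.sub_snd]
      nlinarith [mul_nonneg (sq_nonneg (I.σx / 8)) (sq_nonneg ‖w.fst - w'.fst‖)]
  · refine ⟨I.L + I.σx / 2, by positivity, ?_, key _ (by positivity) fun w hw w' hw' => ?_⟩
    · rw [hstep, div_le_iff₀ (by positivity)]
      have e : 8 * (I.L + I.σx / 2) / I.σx = 8 * I.L / I.σx + 4 := by
        field_simp
        ring
      have h8 : 8 ≤ 8 * I.L / I.σx := by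
        rw [le_div_iff₀ hσ]
        linarith
      rw [e]
      nlinarith
    · rw [hnorm, mul_pow, norm_sq_pt, mul_add]
      rw [WithLp.sub_fst, WithLp.sub_snd]
      refine add_le_add le_rfl (mul_le_mul_of_nonneg_right ?_ (sq_nonneg _))
      exact pow_le_pow_left₀ (by positivity) (by linarith) 2

/-- The iterates of the inner loop, continued without regard to the stopping test. -/
noncomputable def innerSeq (I : Input n m) (s : Outer n m) : ℕ → Inner n m
  | 0 => I.inner0 s
  | t + 1 => I.innerNext s t (I.inner0 s) (innerSeq I s t)

theorem innerStep_pos (hI : I.Assumptions U V) : 0 < I.innerStep :=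
  mul_pos (zeta_pos hI) (gam_pos hI)

theorem innerSeq_isSubgradPair (hI : I.Assumptions U V) (s : Outer n m) (t : ℕ) :
    IsSubgradPair I.p I.q (pair (I.innerSeq s t).x (I.innerSeq s t).y)
      (pair (I.innerSeq s t).bx (I.innerSeq s t).bY) := by
  have hc := innerStep_pos hI
  cases t with
  | zero => exact ⟨prox_isSubgrad hI.convex_p hI.compact_p hc _,
      prox_isSubgrad hI.convex_q hI.compact_q hc _⟩
  | succ t => exact ⟨prox_isSubgrad hI.convex_p hI.compact_p hc _,
      prox_isSubgrad hI.convex_q hI.compact_q hc _⟩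

theorem loopCond_iff (s : Outer n m) (i : Inner n m) :
    I.LoopCond s i ↔ (gam I.σx)⁻¹ * ‖pair i.x i.y - pair (I.xInit s) (I.yg s)‖ ^ 2
      < gam I.σx * ‖I.innerOp s (pair i.x i.y) + pair i.bx i.bY‖ ^ 2 := by
  rw [LoopCond, norm_sq_pt, norm_sq_pt, mul_add, mul_add]
  rfl

/-- A number of inner iterations that suffices. The factor `64` lies between `14 · 2 √5`, which the
residual bound asks for, and `48 √2`, which the count of the oracle calls allows. -/
noncomputable def innerBound (I : Input n m) : ℕ := ⌈64 * (1 + 8 * I.L / I.σx)⌉₊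

/-- The inner loop stops: if the loop condition held up to `innerBound`, all half steps until then
would be taken at admissible points, and the residual bound would contradict the condition. -/
theorem exists_not_loopCond (hI : I.Assumptions U V) (s : Outer n m)
    (hbase : pair (I.xInit s) (I.yg s) ∈ box U V)
    (hhalf : ∀ t, (∀ t' ≤ t, I.LoopCond s (I.innerSeq s t')) →
      pair (I.halfX s t (I.inner0 s) (I.innerSeq s t))
        (I.halfY s t (I.inner0 s) (I.innerSeq s t)) ∈ box U V) :
    ∃ t ≤ I.innerBound, ¬ I.LoopCond s (I.innerSeq s t) := by
  by_contra! hcon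
  have hγ := gam_pos hI
  have hζ := zeta_pos hI
  have hc := innerStep_pos hI
  obtain ⟨ℓ, hℓ0, hℓ, hlip⟩ := exists_innerOp_lipschitz hI
  obtain ⟨us, hus⟩ := exists_isSubgradPair_neg hI.convex_p hI.convex_q hI.compact_p hI.compact_q
    (I.innerOp s) (inv_pos.2 hγ) hℓ0
    (fun w hw w' hw' => innerOp_monotone hI s (hI.dom_box_sub hw) (hI.dom_box_sub hw'))
    (fun w hw w' hw' => hlip s w (hI.dom_box_sub hw) w' (hI.dom_box_sub hw'))
  set um := pair (I.xInit s) (I.yg s) with hum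
  set u : ℕ → Pt n m := fun t => pair (I.innerSeq s t).x (I.innerSeq s t).y with hu
  set b : ℕ → Pt n m := fun t => pair (I.innerSeq s t).bx (I.innerSeq s t).bY with hb
  set w : ℕ → Pt n m := fun t => pair (I.halfX s t (I.inner0 s) (I.innerSeq s t))
    (I.halfY s t (I.inner0 s) (I.innerSeq s t)) with hw
  have hsub : ∀ t, IsSubgradPair I.p I.q (u t) (b t) := innerSeq_isSubgradPair hI s
  have hmem : ∀ t, u t ∈ box U V := fun t => hI.dom_box_sub (hsub t).mem_box
  have husm := hI.dom_box_sub hus.mem_box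
  have hwm : ∀ t < I.innerBound, w t ∈ box U V := fun t ht =>
    hhalf t fun t' ht' => hcon t' (by omega)
  have hb0 : b 0 = I.innerStep⁻¹ • ((um - I.innerStep • I.innerOp s um) - u 0) := rfl
  have hstart : u 0 = um - I.innerStep • (I.innerOp s um + b 0) := by
    rw [hb0, smul_add, smul_inv_smul₀ hc.ne']
    abel
  have hfull : ∀ t, u (t + 1) = u t + beta t • (u 0 - u t)
      - I.innerStep • (I.innerOp s (w t) + b (t + 1)) := by
    intro t
    have hbt : b (t + 1) = I.innerStep⁻¹ • ((u t + beta t • (u 0 - u t)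
      - I.innerStep • I.innerOp s (w t)) - u (t + 1)) := rfl
    rw [hbt, smul_add, smul_inv_smul₀ hc.ne']
    abel
  have hT : 14 ≤ (I.innerBound : ℝ) * zeta I.σx I.L := by
    have h1 : 64 * (1 + 8 * I.L / I.σx) ≤ I.innerBound := Nat.le_ceil _
    have hκ := one_add_ratio_pos hI
    have h5 : √5 < 2.24 := by
      rw [Real.sqrt_lt' (by norm_num)]
      norm_num
    rw [zeta, ← div_eq_mul_inv, le_div_iff₀ (mul_pos (by positivity) hκ)]
    nlinarith
  have hdist0 : ‖u 0 - us‖ ≤ 1.05 * ‖um - us‖ := by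
    have h1 := hsub 0
    rw [hb0] at h1
    have h2 : IsSubgradPair I.p I.q us
        (I.innerStep⁻¹ • ((us - I.innerStep • I.innerOp s us) - us)) := by
      rwa [sub_sub_cancel_left, smul_neg, inv_smul_smul₀ hc.ne']
    have h3 := h1.norm_sub_le hc h2
    have h4 := norm_forward_sq_le hc.le (innerOp_monotone hI s hbase husm) (hlip s _ hbase _ husm)
    have h5 : 1 - 2 * I.innerStep * (gam I.σx)⁻¹ + (I.innerStep * ℓ) ^ 2 ≤ 1.05 ^ 2 := by
      have h6 : (I.innerStep * ℓ) ^ 2 ≤ 0.3 ^ 2 := pow_le_pow_left₀ (by positivity) hℓ 2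
      have h7 : 0 ≤ 2 * I.innerStep * (gam I.σx)⁻¹ := by positivity
      linarith
    have h8 := h4.trans (mul_le_mul_of_nonneg_right h5 (sq_nonneg _))
    rw [← mul_pow] at h8
    exact h3.trans ((sq_le_sq₀ (norm_nonneg _) (by positivity)).1 h8)
  have hinv := (inv_pos.2 hγ).le
  have hres := anchored_residual_le (I.innerOp s) u b w um us I.innerBound hγ hζ (zeta_le hI) hT hℓ
    (fun t _ => rfl) (fun t _ => hfull t)
    (fun t _ => by
      rw [add_sub_add_comm, inner_add_left]
      exact add_nonneg (le_trans (by positivity) (innerOp_monotone hI s (hmem (t + 1)) (hmem t)))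
        ((hsub (t + 1)).monotone (hsub t)))
    (fun t ht => hlip s _ (hmem _) _ (hwm t ht))
    (by
      have e : I.innerOp s (u I.innerBound) + b I.innerBound
        = (I.innerOp s (u I.innerBound) - I.innerOp s us) + (b I.innerBound - -I.innerOp s us) := by
        abel
      rw [e, inner_add_left]
      linarith [innerOp_monotone hI s (hmem I.innerBound) husm, (hsub I.innerBound).monotone hus])
    hstart (hlip s _ (hmem 0) _ hbase) hdist0
  have hloop := (loopCond_iff s _).1 (hcon I.innerBound le_rfl)
  change (gam I.σx)⁻¹ * ‖u I.innerBound - um‖ ^ 2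
    < gam I.σx * ‖I.innerOp s (u I.innerBound) + b I.innerBound‖ ^ 2 at hloop
  have h1 := pow_le_pow_left₀ (by positivity) hres 2
  rw [inv_mul_lt_iff₀ hγ] at hloop
  nlinarith

/-! ### Subgradients and stationarity -/

/-- A subgradient in the sense of convex analysis belongs to the subdifferential. -/
theorem mem_subdiff_of_forall_le {φ : Vec n → EReal} {x s : Vec n} {a : ℝ} (hx : φ x = a)
    (h : ∀ x', ((a + inner ℝ s (x' - x) : ℝ) : EReal) ≤ φ x') : s ∈ subdiff φ x := by
  refine ⟨hx ▸ EReal.coe_ne_top _, hx ▸ EReal.coe_ne_bot _, fun d => ?_⟩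
  by_contra! hlt
  obtain ⟨r, hr1, hr2⟩ := EReal.lt_iff_exists_real_btwn.1 hlt
  rw [EReal.coe_lt_coe_iff] at hr2
  set δ : ℝ := (inner ℝ s d - r) / (‖s‖ + 1) with hδ
  have hs : 0 < ‖s‖ + 1 := by positivity
  have hδ0 : 0 < δ := div_pos (by linarith) hs
  have hδs : ‖s‖ * δ ≤ inner ℝ s d - r := by
    have : (‖s‖ + 1) * δ = inner ℝ s d - r := mul_div_cancel₀ _ hs.ne'
    nlinarith
  refine absurd hr1 (not_lt.2 ?_)
  refine le_trans ?_ (le_iSup _ (⟨δ, hδ0⟩ : {δ : ℝ // 0 < δ}))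
  refine le_limsup_of_frequently_le ?_
  -- base points equal to `x` are admitted in the upper limit
  have hle : pure x ×ˢ 𝓝[>] (0 : ℝ) ≤ (𝓝 x ⊓ comap φ (𝓝 (φ x))) ×ˢ 𝓝[>] (0 : ℝ) :=
    Filter.prod_mono (le_inf (pure_le_nhds x)
      (map_le_iff_le_comap.1 (by rw [map_pure]; exact pure_le_nhds _))) le_rfl
  refine Frequently.filter_mono (Eventually.frequently ?_) hle
  rw [Filter.pure_prod, eventually_map]
  filter_upwards [self_mem_nhdsWithin] with t (ht : 0 < t)
  refine le_iInf₂ fun d' hd' => ?_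
  have h1 := h (x + t • d')
  rw [add_sub_cancel_left, inner_smul_right] at h1
  have h2 : ((t * inner ℝ s d' : ℝ) : EReal) ≤ φ (x + t • d') - φ x := by
    refine le_trans (le_of_eq ?_) (EReal.sub_le_sub h1 hx.le)
    rw [← EReal.coe_sub, add_sub_cancel_left]
  have h3 := mul_le_mul_of_nonneg_left h2
    (EReal.coe_nonneg.2 (inv_nonneg.2 ht.le) : (0 : EReal) ≤ ((t⁻¹ : ℝ) : EReal))
  refine le_trans ?_ h3
  rw [← EReal.coe_mul, inv_mul_cancel_left₀ ht.ne', EReal.coe_le_coe_iff]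
  have h4 : inner ℝ s (d - d') ≤ ‖s‖ * δ := by
    refine (real_inner_le_norm _ _).trans (mul_le_mul_of_nonneg_left ?_ (norm_nonneg _))
    rw [← dist_eq_norm, dist_comm]
    exact (Metric.mem_ball.1 hd').le
  rw [inner_sub_right] at h4
  linarith

theorem infEDist_zero_le {S : Set (Vec n)} {s : Vec n} {ε : ℝ} (hs : s ∈ S) (h : ‖s‖ ≤ ε) :
    Metric.infEDist 0 S ≤ ENNReal.ofReal ε := by
  refine (Metric.infEDist_le_edist_of_mem hs).trans ?_
  rw [edist_dist, dist_zero_left]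
  exact ENNReal.ofReal_le_ofReal h

theorem norm_fst_le_pt (w : Pt n m) : ‖w.fst‖ ≤ ‖w‖ := WithLp.norm_fst_le _ w

theorem norm_snd_le_pt (w : Pt n m) : ‖w.snd‖ ≤ ‖w‖ := WithLp.norm_snd_le _ w

theorem fbStep_pos (hI : I.Assumptions U V) : 0 < I.fbStep :=
  div_pos (lt_min hI.σx_pos hI.σy_pos) (pow_pos hI.L_pos 2)

/-- The forward-backward step, with its optimality condition. -/
theorem tilde_isSubgradPair (hI : I.Assumptions U V) (s : Outer n m) :
    IsSubgradPair I.p I.q (pair (I.xTilde s) (I.yTilde s))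
      (I.fbStep⁻¹ • ((pair (I.xOf s) s.y - I.fbStep • saddleOp I.h (pair (I.xOf s) s.y))
        - pair (I.xTilde s) (I.yTilde s))) := by
  have h := isSubgradPair_prox hI.convex_p hI.convex_q hI.compact_p hI.compact_q (fbStep_pos hI)
    (pair (I.fbX s) (I.fbY s))
  have e : pair (I.fbX s) (I.fbY s)
      = pair (I.xOf s) s.y - I.fbStep • saddleOp I.h (pair (I.xOf s) s.y) := by
    refine Pt.ext rfl ?_
    change s.y + I.fbStep • I.gy (I.xOf s) s.y = s.y - I.fbStep • -(I.gy (I.xOf s) s.y)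
    rw [smul_neg, sub_neg_eq_add]
  rw [← e]
  exact h

theorem isStationary_of_terminates (hI : I.Assumptions U V) {s : Outer n m}
    (h : I.Terminates s) : IsStationary I.H I.ε (I.xTilde s) (I.yTilde s) := by
  obtain ⟨hx, hy⟩ := tilde_isSubgradPair hI s
  have hc := fbStep_pos hI
  rw [Terminates] at h
  set x := I.xTilde s
  set y := I.yTilde s
  set g := I.fbStep⁻¹ • pair (I.xOf s - x) (y - s.y)
    - (gradient I.h (pair (I.xOf s) s.y) - gradient I.h (pair x y)) with hg
  have hxp : x ∈ dom I.p := hx.1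
  have hyq : y ∈ dom I.q := hy.1
  have hd := hI.smooth.1 _ (hI.dom_box_sub ⟨hxp, hyq⟩ : pair x y ∈ box U V)
  have hgx : (I.fbStep⁻¹ • ((pair (I.xOf s) s.y - I.fbStep • saddleOp I.h (pair (I.xOf s) s.y))
      - pair x y)).fst = g.fst - (gradient I.h (pair x y)).fst := by
    change I.fbStep⁻¹ • ((I.xOf s - I.fbStep • (gradient I.h (pair (I.xOf s) s.y)).fst) - x)
      = (I.fbStep⁻¹ • (I.xOf s - x) - ((gradient I.h (pair (I.xOf s) s.y)).fst
        - (gradient I.h (pair x y)).fst)) - (gradient I.h (pair x y)).fst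
    rw [smul_sub, smul_sub, inv_smul_smul₀ hc.ne', smul_sub]
    abel
  have hgy : (I.fbStep⁻¹ • ((pair (I.xOf s) s.y - I.fbStep • saddleOp I.h (pair (I.xOf s) s.y))
      - pair x y)).snd = (gradient I.h (pair x y)).snd - g.snd := by
    change I.fbStep⁻¹ • ((s.y - I.fbStep • -(gradient I.h (pair (I.xOf s) s.y)).snd) - y)
      = (gradient I.h (pair x y)).snd - (I.fbStep⁻¹ • (y - s.y)
        - ((gradient I.h (pair (I.xOf s) s.y)).snd - (gradient I.h (pair x y)).snd))
    rw [smul_sub, smul_sub, smul_neg, smul_neg, inv_smul_smul₀ hc.ne', smul_sub]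
    abel
  rw [hgx] at hx
  rw [hgy] at hy
  refine ⟨infEDist_zero_le (s := g.fst) ?_ ((norm_fst_le_pt g).trans h),
    infEDist_zero_le (s := g.snd) ?_ ((norm_snd_le_pt g).trans h)⟩
  · refine mem_subdiff_of_forall_le (hI.H_eq hxp hyq) fun x' => ?_
    by_cases hx' : x' ∈ dom I.p
    · rw [hI.H_eq hx' hyq, EReal.coe_le_coe_iff]
      have h1 := hI.convex.firstOrder_fst (hI.dom_p_sub hxp) (hI.dom_p_sub hx')
        (hI.dom_q_sub hyq) hd
      have h2 := hx.2 x' hx'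
      rw [inner_sub_left, pair_fst] at h2
      have h3 : 0 ≤ I.σx / 2 * ‖x' - x‖ ^ 2 :=
        mul_nonneg (by linarith [hI.σx_pos]) (sq_nonneg _)
      linarith
    · rw [hI.H_eq_top hx' hyq]
      exact le_top
  · refine mem_subdiff_of_forall_le (φ := fun y' => -I.H x y')
      (a := -(I.h (pair x y) + (I.p x).toReal - (I.q y).toReal))
      (by rw [hI.H_eq hxp hyq, EReal.coe_neg]) fun y' => ?_
    by_cases hy' : y' ∈ dom I.q
    · rw [hI.H_eq hxp hy', ← EReal.coe_neg, EReal.coe_le_coe_iff]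
      have h1 := hI.convex.firstOrder_snd (hI.dom_p_sub hxp) (hI.dom_q_sub hyq)
        (hI.dom_q_sub hy') hd
      have h2 := hy.2 y' hy'
      rw [inner_sub_left, pair_snd] at h2
      have h3 : 0 ≤ I.σy / 2 * ‖y' - y‖ ^ 2 :=
        mul_nonneg (by linarith [hI.σy_pos]) (sq_nonneg _)
      rw [inner_neg_left]
      linarith
    · rw [H_eq_bot x hy', EReal.neg_bot]
      exact le_top

/-! ### The outer loop -/

/-- The potential `ϑ` of the outer variables; `theta0` is its initial value. -/
noncomputable def theta (I : Input n m) (xs : Vec n) (ys : Vec m) (s : Outer n m) : ℝ :=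
  (etaZ I.σx)⁻¹ * ‖s.z - -(I.σx • xs)‖ ^ 2 + (etaY I.σx I.σy)⁻¹ * ‖s.y - ys‖ ^ 2
    + 2 * (alpha I.σx I.σy)⁻¹ * (I.P s.zf s.yf - I.P (-(I.σx • xs)) ys)

/-- One outer iteration contracts the potential by the factor `1 - α / 2`. -/
theorem theta_outerNext_le (hI : I.Assumptions U V) {xs : Vec n} {ys : Vec m}
    (h : I.IsSaddle xs ys) {s : Outer n m} (hyf : s.yf ∈ dom I.q) {i : Inner n m}
    (hi : IsSubgradPair I.p I.q (pair i.x i.y) (pair i.bx i.bY)) (hloop : ¬ I.LoopCond s i) :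
    I.theta xs ys (I.outerNext s i) ≤ (1 - alpha I.σx I.σy / 2) * I.theta xs ys s := by
  have hx := hI.σx_pos
  have hy := hI.σy_pos
  have ha := alpha_pos hx hy
  have hη : etaZ I.σx * I.σx⁻¹ = 1 / 2 := by
    rw [etaZ]
    field_simp
  have hPsc := fun z' y' hy' => hI.P_strongConvex hi.1 hi.2 (z := I.zfNext i) (w := I.wfNext i)
    rfl rfl z' (y' := y') hy'
  simp only [pair_fst, pair_snd] at hPsc
  refine potential_contraction (σ := I.σx) (μz := I.σx⁻¹) (μy := I.σy) (zf := I.zfNext i)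
    (yf := i.y) (zf₀ := s.zf) (yf₀ := s.yf) (gz := i.x + I.σx⁻¹ • I.zfNext i)
    (gy := I.wfNext i + I.σy • i.y) ha alpha_le_one (by rw [etaZ]; positivity) (etaY_pos hx hy)
    (inv_pos.2 hx).le hy.le hη.le (etaY_mul_le hy)
    (by rw [hη]; linarith [alpha_le_one (σx := I.σx) (σy := I.σy)]) (le_etaY_mul hx hy)
    (by rw [etaZ]; nlinarith [alpha_le_one (σx := I.σx) (σy := I.σy)]) (etaY_alpha_le hx hy)
    rfl rfl ?_ ?_ (hPsc _ _ h.mem_q) (h.P_le hI _ hyf)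
  · refine inner_le_of_accuracy hx ?_
    rw [LoopCond, not_lt] at hloop
    have e1 : I.ax s i.x i.y + i.bx = (1 / 2 : ℝ) • (I.zfNext i - (alpha I.σx I.σy • s.z
        + (1 - alpha I.σx I.σy) • s.zf) + I.σx • (i.x + I.σx⁻¹ • I.zfNext i)) := by
      have e : (I.σx / 2) • I.σx⁻¹ • I.zg s = (1 / 2 : ℝ) • I.zg s := by
        rw [smul_smul, show I.σx / 2 * I.σx⁻¹ = 1 / 2 from hη]
      rw [smul_add I.σx, smul_inv_smul₀ hx.ne', ax, smul_sub, e, zg, zfNext]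
      module
    have e2 : I.ay s i.x i.y + i.bY = (I.wfNext i + I.σy • i.y) + (I.σx / 8) •
        (i.y - (alpha I.σx I.σy • s.y + (1 - alpha I.σx I.σy) • s.yf)) := by
      rw [ay, wfNext, yg]
      abel
    have e3 : i.x - I.xInit s = i.x + I.σx⁻¹ • I.zfNext i - I.σx⁻¹ • (I.zfNext i -
        (alpha I.σx I.σy • s.z + (1 - alpha I.σx I.σy) • s.zf)) := by
      rw [xInit, zg]
      module
    rw [e1, e2, e3] at hloop
    exact hloop
  · have h1 := hPsc s.zf s.yf hyf
    have h2 : 0 ≤ I.σx⁻¹ / 2 * ‖s.zf - I.zfNext i‖ ^ 2 := by positivity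
    have h3 : 0 ≤ I.σy / 2 * ‖s.yf - i.y‖ ^ 2 := by positivity
    change I.P (I.zfNext i) i.y + _ + _ ≤ _
    linarith

theorem norm_sq_le_theta (hI : I.Assumptions U V) {xs : Vec n} {ys : Vec m}
    (h : I.IsSaddle xs ys) {s : Outer n m} (hyf : s.yf ∈ dom I.q) :
    ‖pair (I.xOf s) s.y - pair xs ys‖ ^ 2
      ≤ max (etaZ I.σx * I.σx ^ (-2 : ℤ)) (etaY I.σx I.σy) * I.theta xs ys s := by
  have hx := hI.σx_pos
  have hηy := etaY_pos hx hI.σy_pos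
  have ha := alpha_pos hx hI.σy_pos
  set M := max (etaZ I.σx * I.σx ^ (-2 : ℤ)) (etaY I.σx I.σy) with hM
  have hM0 : 0 ≤ M := le_max_of_le_right hηy.le
  have e1 : I.xOf s - xs = -(I.σx⁻¹ • (s.z - -(I.σx • xs))) := by
    rw [xOf, sub_neg_eq_add, smul_add, inv_smul_smul₀ hx.ne']
    abel
  have h1 : ‖I.xOf s - xs‖ ^ 2 ≤ M * ((etaZ I.σx)⁻¹ * ‖s.z - -(I.σx • xs)‖ ^ 2) := by
    have e2 : ‖I.xOf s - xs‖ ^ 2 = etaZ I.σx * I.σx ^ (-2 : ℤ)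
        * ((etaZ I.σx)⁻¹ * ‖s.z - -(I.σx • xs)‖ ^ 2) := by
      rw [e1, norm_neg, norm_smul, mul_pow, Real.norm_of_nonneg (inv_pos.2 hx).le, etaZ, zpow_neg]
      norm_cast
      field_simp
    rw [e2]
    exact mul_le_mul_of_nonneg_right (le_max_left _ _) (by rw [etaZ]; positivity)
  have h2 : ‖s.y - ys‖ ^ 2 ≤ M * ((etaY I.σx I.σy)⁻¹ * ‖s.y - ys‖ ^ 2) := by
    have e2 : ‖s.y - ys‖ ^ 2 = etaY I.σx I.σy * ((etaY I.σx I.σy)⁻¹ * ‖s.y - ys‖ ^ 2) := by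
      rw [mul_inv_cancel_left₀ hηy.ne']
    conv_lhs => rw [e2]
    exact mul_le_mul_of_nonneg_right (le_max_right _ _) (by positivity)
  have h3 : 0 ≤ M * (2 * (alpha I.σx I.σy)⁻¹ * (I.P s.zf s.yf - I.P (-(I.σx • xs)) ys)) :=
    mul_nonneg hM0 (mul_nonneg (by positivity) (sub_nonneg.2 (h.P_le hI _ hyf)))
  rw [norm_sq_pt]
  change ‖I.xOf s - xs‖ ^ 2 + ‖s.y - ys‖ ^ 2 ≤ _
  rw [theta]
  linarith

theorem theta_nonneg (hI : I.Assumptions U V) {xs : Vec n} {ys : Vec m}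
    (h : I.IsSaddle xs ys) {s : Outer n m} (hyf : s.yf ∈ dom I.q) : 0 ≤ I.theta xs ys s := by
  have hx := hI.σx_pos
  have hηy := etaY_pos hx hI.σy_pos
  have ha := alpha_pos hx hI.σy_pos
  have h1 := sub_nonneg.2 (h.P_le hI s.zf hyf)
  rw [theta, etaZ]
  positivity

/-- The forward-backward step is nonexpansive towards the saddle point, so that the termination test
succeeds near it. -/
theorem terminates_of_norm_le (hI : I.Assumptions U V) {xs : Vec n} {ys : Vec m}
    (h : I.IsSaddle xs ys) {s : Outer n m} (hbox : pair (I.xOf s) s.y ∈ box U V)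
    (hnorm : 2 * ((zetaBar I.σx I.σy I.L)⁻¹ + I.L) * ‖pair (I.xOf s) s.y - pair xs ys‖ ≤ I.ε) :
    I.Terminates s := by
  have hc := fbStep_pos hI
  have hL := hI.L_pos
  have hmin : 0 < min I.σx I.σy := lt_min hI.σx_pos hI.σy_pos
  have hsub := tilde_isSubgradPair hI s
  rw [Terminates]
  set u := pair (I.xOf s) s.y with hu
  set v := pair (I.xTilde s) (I.yTilde s) with hv
  set us := pair xs ys with hus
  have hvbox := hI.dom_box_sub hsub.mem_box
  have husbox := hI.dom_box_sub (IsSubgradPair.mem_box h)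
  have h2 : IsSubgradPair I.p I.q us (I.fbStep⁻¹ • ((us - I.fbStep • saddleOp I.h us) - us)) := by
    rw [sub_sub_cancel_left, smul_neg, inv_smul_smul₀ hc.ne']
    exact h
  have hmono : min I.σx I.σy * ‖u - us‖ ^ 2
      ≤ inner ℝ (saddleOp I.h u - saddleOp I.h us) (u - us) := by
    refine le_trans ?_ (saddleOp_monotone hI.convex hI.smooth hbox husbox)
    rw [norm_sq_pt, mul_add]
    exact add_le_add (mul_le_mul_of_nonneg_right (min_le_left _ _) (sq_nonneg _))
      (mul_le_mul_of_nonneg_right (min_le_right _ _) (sq_nonneg _))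
  have h3 : ‖v - us‖ ≤ ‖u - us‖ := by
    refine (hsub.norm_sub_le hc h2).trans ?_
    have h4 := norm_forward_sq_le hc.le hmono (saddleOp_lipschitz hI.smooth hbox husbox)
    have h5 : 1 - 2 * I.fbStep * min I.σx I.σy + (I.fbStep * I.L) ^ 2 ≤ 1 := by
      have e : (I.fbStep * I.L) ^ 2 = I.fbStep * min I.σx I.σy := by
        rw [fbStep, zetaBar]
        field_simp
      rw [e]
      linarith [mul_pos hc hmin]
    have h6 := h4.trans (mul_le_mul_of_nonneg_right h5 (sq_nonneg _))
    rw [one_mul] at h6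
    exact (sq_le_sq₀ (norm_nonneg _) (norm_nonneg _)).1 h6
  have h7 : ‖u - v‖ ≤ 2 * ‖u - us‖ := by
    have := norm_sub_le_norm_sub_add_norm_sub u us v
    rw [norm_sub_rev us v] at this
    linarith
  have h8 : ‖pair (I.xOf s - I.xTilde s) (I.yTilde s - s.y)‖ = ‖u - v‖ := by
    have : ‖pair (I.xOf s - I.xTilde s) (I.yTilde s - s.y)‖ ^ 2 = ‖u - v‖ ^ 2 := by
      rw [norm_sq_pt, norm_sq_pt]
      change ‖I.xOf s - I.xTilde s‖ ^ 2 + ‖I.yTilde s - s.y‖ ^ 2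
        = ‖I.xOf s - I.xTilde s‖ ^ 2 + ‖s.y - I.yTilde s‖ ^ 2
      rw [norm_sub_rev s.y]
    exact (sq_eq_sq₀ (norm_nonneg _) (norm_nonneg _)).1 this
  refine (norm_sub_le _ _).trans ?_
  rw [norm_smul, Real.norm_of_nonneg (inv_pos.2 hc).le, h8]
  have h9 := hI.smooth.2 u hbox v hvbox
  have hk : 0 < I.fbStep⁻¹ + I.L := by positivity
  change 2 * (I.fbStep⁻¹ + I.L) * _ ≤ _ at hnorm
  nlinarith

/-- After `K̄` contractions the potential is so small that the termination test succeeds. -/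
theorem terminates_of_Kbar_le (hI : I.Assumptions U V) {xs : Vec n} {ys : Vec m}
    (h : I.IsSaddle xs ys) {s : Outer n m} (hbox : pair (I.xOf s) s.y ∈ box U V)
    (hyf : s.yf ∈ dom I.q) {θ : ℝ} (hθ : 0 ≤ θ) {K : ℕ} (hK : I.Kbar θ ≤ K)
    (hs : I.theta xs ys s ≤ (1 - alpha I.σx I.σy / 2) ^ K * θ) : I.Terminates s := by
  have hx := hI.σx_pos
  have hη := etaY_pos hx hI.σy_pos
  have ha := alpha_pos hx hI.σy_pos
  have hε := hI.ε_pos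
  have hκ : 0 < (zetaBar I.σx I.σy I.L)⁻¹ + I.L :=
    add_pos (inv_pos.2 (fbStep_pos hI)) hI.L_pos
  refine terminates_of_norm_le hI h hbox ?_
  have h1 := norm_sq_le_theta hI h hyf
  rw [Kbar, rate_eq hx hI.σy_pos] at hK
  set κ := (zetaBar I.σx I.σy I.L)⁻¹ + I.L
  set M := max (etaZ I.σx * I.σx ^ (-2 : ℤ)) (etaY I.σx I.σy)
  set a := alpha I.σx I.σy
  have hM : 0 < M := lt_max_of_lt_right hη
  have ez : κ ^ (-2 : ℤ) = (κ ^ 2)⁻¹ := by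
    rw [zpow_neg]
    norm_cast
  have h2 : M * ((1 - a / 2) ^ K * θ) ≤ (κ ^ 2)⁻¹ * I.ε ^ 2 / 4 := by
    -- for `θ = 0` the logarithm in `K̄` has its conventional value `0`, but nothing is to be shown
    rcases hθ.eq_or_lt with h0 | h0
    · rw [← h0, mul_zero, mul_zero]
      positivity
    rw [ez] at hK
    set X := 4 * M * θ / ((κ ^ 2)⁻¹ * I.ε ^ 2) with hX
    have hX0 : 0 < X := by positivity
    have h3 : 2 / a * Real.log X ≤ K := (Nat.le_ceil _).trans (by exact_mod_cast hK)
    have h4 : (1 - a / 2) ^ K ≤ X⁻¹ := by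
      have h5 : (1 - a / 2) ^ K ≤ Real.exp (-(a / 2)) ^ K :=
        pow_le_pow_left₀ (by have : a ≤ 1 := alpha_le_one; linarith)
          (Real.one_sub_le_exp_neg _) K
      refine h5.trans ?_
      rw [← Real.exp_nat_mul, ← Real.exp_log (inv_pos.2 hX0), Real.exp_le_exp, Real.log_inv]
      have h6 := mul_le_mul_of_nonneg_left h3 (by positivity : 0 ≤ a / 2)
      have h7 : a / 2 * (2 / a * Real.log X) = Real.log X := by field_simp
      linarith
    calc M * ((1 - a / 2) ^ K * θ) ≤ M * (X⁻¹ * θ) := by gcongr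
      _ = (κ ^ 2)⁻¹ * I.ε ^ 2 / 4 := by
        rw [hX]
        field_simp
  have h3 : ‖pair (I.xOf s) s.y - pair xs ys‖ ^ 2 ≤ (κ ^ 2)⁻¹ * I.ε ^ 2 / 4 :=
    h1.trans ((mul_le_mul_of_nonneg_left hs hM.le).trans h2)
  have h4 : (2 * κ * ‖pair (I.xOf s) s.y - pair xs ys‖) ^ 2 ≤ I.ε ^ 2 := by
    have h5 := mul_le_mul_of_nonneg_left h3 (by positivity : 0 ≤ 4 * κ ^ 2)
    have h6 : 4 * κ ^ 2 * ((κ ^ 2)⁻¹ * I.ε ^ 2 / 4) = I.ε ^ 2 := by field_simp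
    rw [h6] at h5
    linarith
  exact (sq_le_sq₀ (by positivity) hε.le).1 h4

/-! ### Runs of the algorithm -/

/-- The lists in the log `l` exceed those in `l₀` by at most `c` entries. -/
def _root_.Minimax.Log.LengthLe (l l₀ : Log n m) (c : ℕ) : Prop :=
  l.grad.length ≤ l₀.grad.length + c ∧ l.proxP.length ≤ l₀.proxP.length + c ∧
    l.proxQ.length ≤ l₀.proxQ.length + c

theorem mem_of_mem_step (hquery : ∀ j, ∀ w ∈ (I.run j).2.grad, w ∈ box U V) {j : ℕ}
    {c : Config n m} (hc : (I.run j).1 = c) {w : Pt n m} (hw : w ∈ (I.step c).2.grad) :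
    w ∈ box U V := by
  refine hquery (j + 1) w ?_
  change w ∈ (I.run j).2.grad ++ (I.step (I.run j).1).2.grad
  rw [hc]
  exact List.mem_append_right _ hw

/-- As long as the loop condition holds, the algorithm runs through the iterates of the inner loop. -/
theorem run_inner {j k : ℕ} {s : Outer n m} (hj : (I.run j).1 = .outer k s) (t : ℕ)
    (ht : ∀ t' < t, I.LoopCond s (I.innerSeq s t')) :
    (I.run (j + 1 + t)).1 = .inner k s t (I.inner0 s) (I.innerSeq s t) ∧
      (I.run (j + 1 + t)).2.LengthLe (I.run j).2 (2 * t + 1) := by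
  induction t with
  | zero =>
    refine ⟨?_, ?_⟩
    · change (I.step (I.run j).1).1 = _
      rw [hj]
      rfl
    · change ((I.run j).2.append (I.step (I.run j).1).2).LengthLe _ _
      rw [hj]
      simp [Log.LengthLe, Log.append, step]
  | succ t ih =>
    obtain ⟨h1, h2⟩ := ih fun t' ht' => ht t' (by omega)
    have hstep := ht t (by omega)
    refine ⟨?_, ?_⟩
    · change (I.step (I.run (j + 1 + t)).1).1 = _
      rw [h1, step, if_pos hstep]
      rfl
    · change ((I.run (j + 1 + t)).2.append (I.step (I.run (j + 1 + t)).1).2).LengthLe _ _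
      rw [h1, step, if_pos hstep]
      simp only [Log.LengthLe, Log.append, List.length_append, List.length_cons,
        List.length_nil] at h2 ⊢
      omega

/-- The bound on the number of oracle calls of each kind in one outer iteration. -/
noncomputable def roundCost (I : Input n m) : ℕ := ⌈96 * √2 * (1 + 8 * I.L * I.σx⁻¹)⌉₊ + 2

/-- With `t` inner iterations an outer iteration makes `2 t + 4` gradient evaluations. -/
theorem innerBound_cost (hI : I.Assumptions U V) : 2 * I.innerBound + 4 ≤ I.roundCost := by
  have h1 : (I.innerBound : ℝ) < 64 * (1 + 8 * I.L / I.σx) + 1 :=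
    Nat.ceil_lt_add_one (mul_nonneg (by norm_num) (one_add_ratio_pos hI).le)
  have h2 : (96 * √2 * (1 + 8 * I.L * I.σx⁻¹) : ℝ) ≤ (⌈96 * √2 * (1 + 8 * I.L * I.σx⁻¹)⌉₊ : ℝ) :=
    Nat.le_ceil _
  have h3 : (1.41 : ℝ) < √2 := by
    rw [Real.lt_sqrt (by norm_num)]
    norm_num
  have h4 : 1 ≤ 1 + 8 * I.L / I.σx := by
    have := hI.L_pos
    have := hI.σx_pos
    have : 0 < 8 * I.L / I.σx := by positivity
    linarith
  rw [← div_eq_mul_inv] at h2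
  have h5 : 135 * (1 + 8 * I.L / I.σx) ≤ 96 * √2 * (1 + 8 * I.L / I.σx) :=
    mul_le_mul_of_nonneg_right (by linarith) (by linarith)
  rw [roundCost, ← div_eq_mul_inv]
  have h6 : ((2 * I.innerBound + 4 : ℕ) : ℝ) < ((⌈96 * √2 * (1 + 8 * I.L / I.σx)⌉₊ + 3 : ℕ) : ℝ) := by
    push_cast
    linarith
  have h7 : 2 * I.innerBound + 4 < ⌈96 * √2 * (1 + 8 * I.L / I.σx)⌉₊ + 3 := by exact_mod_cast h6
  omega

open Classical in
/-- One outer iteration: the inner loop ends, and the next outer variables are tested. -/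
theorem exists_round (hI : I.Assumptions U V)
    (hquery : ∀ j, ∀ w ∈ (I.run j).2.grad, w ∈ box U V) {j k : ℕ} {s : Outer n m}
    (hj : (I.run j).1 = .outer k s) :
    ∃ j' i, IsSubgradPair I.p I.q (pair i.x i.y) (pair i.bx i.bY) ∧ ¬ I.LoopCond s i ∧
      pair (I.xOf (I.outerNext s i)) (I.outerNext s i).y ∈ box U V ∧
      (I.run j').1 = (if I.Terminates (I.outerNext s i) then
        .done (k + 1) (I.xTilde (I.outerNext s i)) (I.yTilde (I.outerNext s i))
        else .outer (k + 1) (I.outerNext s i)) ∧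
      (I.run j').2.LengthLe (I.run j).2 I.roundCost := by
  have hex : ∃ t, t ≤ I.innerBound ∧ ¬ I.LoopCond s (I.innerSeq s t) := by
    refine exists_not_loopCond hI s (mem_of_mem_step hquery hj ?_) fun t ht => ?_
    · simp [step]
    · have h1 := (run_inner hj t fun t' ht' => ht t' ht'.le).1
      refine mem_of_mem_step hquery h1 ?_
      rw [step, if_pos (ht t le_rfl)]
      simp
  obtain ⟨hle, hnot⟩ := Nat.find_spec hex
  have hmin : ∀ t' < Nat.find hex, I.LoopCond s (I.innerSeq s t') := fun t' ht' => by
    by_contra hcon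
    exact Nat.find_min hex ht' ⟨by omega, hcon⟩
  generalize Nat.find hex = t at hle hnot hmin
  obtain ⟨h1, h2⟩ := run_inner hj t hmin
  refine ⟨j + 1 + t + 1, I.innerSeq s t, innerSeq_isSubgradPair hI s t, hnot, ?_, ?_, ?_⟩
  · refine mem_of_mem_step hquery h1 ?_
    rw [step, if_neg hnot]
    simp
  · change (I.step (I.run (j + 1 + t)).1).1 = _
    rw [h1, step, if_neg hnot]
  · change ((I.run (j + 1 + t)).2.append (I.step (I.run (j + 1 + t)).1).2).LengthLe _ _
    rw [h1, step, if_neg hnot]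
    have := innerBound_cost hI
    simp only [Log.LengthLe, Log.append, List.length_append, List.length_cons,
      List.length_nil] at h2 ⊢
    omega

/-- After `k` outer iterations the algorithm has halted or the potential has decreased `k` times;
either way the oracle calls are bounded. -/
theorem exists_run (hI : I.Assumptions U V)
    (hquery : ∀ j, ∀ w ∈ (I.run j).2.grad, w ∈ box U V) {xs : Vec n} {ys : Vec m}
    (h : I.IsSaddle xs ys) (hy0 : I.y0 ∈ dom I.q) (k : ℕ) :
    (∃ j s, (I.run j).1 = .outer k s ∧ s.yf ∈ dom I.q ∧
      I.theta xs ys s ≤ (1 - alpha I.σx I.σy / 2) ^ k * I.theta0 xs ys ∧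
      (k ≠ 0 → pair (I.xOf s) s.y ∈ box U V ∧ ¬ I.Terminates s) ∧
      (I.run j).2.LengthLe ⟨[], [], []⟩ (k * I.roundCost)) ∨
    ∃ j K x y, (I.run j).1 = .done K x y ∧ K ≤ k ∧ IsStationary I.H I.ε x y ∧
      (I.run j).2.LengthLe ⟨[], [], []⟩ (K * I.roundCost) := by
  induction k with
  | zero =>
    refine Or.inl ⟨0, ⟨I.z0, I.y0, I.z0, I.y0⟩, rfl, hy0, ?_, fun h => absurd rfl h, ?_⟩
    · rw [pow_zero, one_mul]
      exact le_rfl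
    · simp [Log.LengthLe, run]
  | succ k ih =>
    rcases ih with ⟨j, s, hj, hyf, hθ, -, hlen⟩ | ⟨j, K, x, y, hj, hK, hst, hlen⟩
    · obtain ⟨j', i, hi, hloop, hbox, hj', hlen'⟩ := exists_round hI hquery hj
      have hlen'' : (I.run j').2.LengthLe ⟨[], [], []⟩ ((k + 1) * I.roundCost) := by
        simp only [Log.LengthLe, List.length_nil, add_mul, one_mul] at hlen hlen' ⊢
        omega
      by_cases hT : I.Terminates (I.outerNext s i)
      · rw [if_pos hT] at hj'
        exact Or.inr ⟨j', k + 1, _, _, hj', le_rfl, isStationary_of_terminates hI hT, hlen''⟩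
      · rw [if_neg hT] at hj'
        refine Or.inl ⟨j', _, hj', hi.2.1, ?_, fun _ => ⟨hbox, hT⟩, hlen''⟩
        have ha : alpha I.σx I.σy ≤ 1 := alpha_le_one
        refine (theta_outerNext_le hI h hyf hi hloop).trans ?_
        rw [pow_succ', mul_assoc]
        exact mul_le_mul_of_nonneg_left hθ (by linarith)
    · exact Or.inr ⟨j, K, x, y, hj, by omega, hst, hlen⟩

theorem exists_done (hI : I.Assumptions U V)
    (hquery : ∀ j, ∀ w ∈ (I.run j).2.grad, w ∈ box U V) {xs : Vec n} {ys : Vec m}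
    (h : I.IsSaddle xs ys) (hy0 : I.y0 ∈ dom I.q) :
    ∃ j K x y, (I.run j).1 = .done K x y ∧ K ≤ max 1 (I.Kbar (I.theta0 xs ys)) ∧
      IsStationary I.H I.ε x y ∧ (I.run j).2.LengthLe ⟨[], [], []⟩ (K * I.roundCost) := by
  rcases exists_run hI hquery h hy0 (max 1 (I.Kbar (I.theta0 xs ys))) with
    ⟨j, s, -, hyf, hθ, hT, -⟩ | hdone
  · obtain ⟨hbox, hnot⟩ := hT (by omega)
    have h0 : 0 ≤ I.theta0 xs ys :=
      theta_nonneg (s := ⟨I.z0, I.y0, I.z0, I.y0⟩) hI h hy0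
    exact absurd (terminates_of_Kbar_le hI h hbox hyf h0 (le_max_right _ _) hθ) hnot
  · exact hdone

/-! ### The complexity bound -/

theorem Kbar_le_Nouter (hI : I.Assumptions U V) {θ : ℝ} (h0 : 0 ≤ θ)
    (hθ : θ ≤ I.deltaBar + 2 * (alpha I.σx I.σy)⁻¹ * (I.Hstar.toReal - I.Hlow.toReal)) :
    I.Kbar θ ≤ I.Nouter I.ε := by
  have hx := hI.σx_pos
  have hy := hI.σy_pos
  have hL := hI.L_pos
  have hε := hI.ε_pos
  have hη := etaY_pos hx hy
  rw [Kbar, Nouter, rate_eq hx hy, rate_eq_sqrt hx hy]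
  -- for `θ = 0` the left side is `0`, by the convention `log 0 = 0`
  rcases h0.eq_or_lt with h | h
  · rw [← h, mul_zero, zero_div, Real.log_zero, mul_zero, Nat.ceil_zero]
    exact Nat.zero_le _
  have e1 : etaZ I.σx * I.σx ^ (-2 : ℤ) = 1 / (2 * I.σx) := by
    rw [etaZ, zpow_neg]
    norm_cast
    field_simp
  have e2 : (zetaBar I.σx I.σy I.L)⁻¹ = I.L ^ 2 / min I.σx I.σy := by
    rw [zetaBar, inv_div]
  rw [e1, e2]
  change _ ≤ ⌈2 / alpha I.σx I.σy * Real.log (4 * max (1 / (2 * I.σx)) (etaY I.σx I.σy) * _ / _)⌉₊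
  have hmin : 0 < min I.σx I.σy := lt_min hx hy
  have ha := alpha_pos hx hy
  have hM : 0 < max (1 / (2 * I.σx)) (etaY I.σx I.σy) := lt_max_of_lt_right hη
  refine Nat.ceil_mono (mul_le_mul_of_nonneg_left (Real.log_le_log (by positivity) ?_)
    (by positivity))
  gcongr

theorem log_div_sq_le {b c ε : ℝ} (hc : 0 < c) (hε : 0 < ε) (hl : 1 ≤ Real.log (1 / ε)) :
    Real.log (b / (c * ε ^ 2)) ≤ (|Real.log (b / c)| + 2) * Real.log (1 / ε) := by
  have h0 := abs_nonneg (Real.log (b / c))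
  rcases eq_or_ne b 0 with rfl | hb
  · rw [zero_div, Real.log_zero]
    positivity
  have e : b / (c * ε ^ 2) = b / c * (1 / ε) ^ 2 := by field_simp
  rw [e, Real.log_mul (div_ne_zero hb hc.ne') (by positivity), Real.log_pow]
  push_cast
  nlinarith [le_abs_self (Real.log (b / c))]

theorem Nbar_isBigO (hI : I.Assumptions U V) :
    (fun ε : ℝ => (I.Nbar ε : ℝ)) =O[𝓝[>] 0] fun ε : ℝ => Real.log (1 / ε) := by
  have hc : 0 < (I.L ^ 2 / min I.σx I.σy + I.L) ^ (-2 : ℤ) := by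
    have := lt_min hI.σx_pos hI.σy_pos
    have := hI.L_pos
    positivity
  set a := max 2 √(I.σx / (2 * I.σy)) with ha
  set c := (I.L ^ 2 / min I.σx I.σy + I.L) ^ (-2 : ℤ)
  set b := 4 * max (1 / (2 * I.σx)) (min (1 / (2 * I.σy)) (4 / (alpha I.σx I.σy * I.σx))) *
      (I.deltaBar + 2 * (alpha I.σx I.σy)⁻¹ * (I.Hstar.toReal - I.Hlow.toReal))
  have ha0 : 0 ≤ a := le_max_of_le_left (by norm_num)
  refine Asymptotics.IsBigO.of_bound ((a * (|Real.log (b / c)| + 2) + 2) * I.roundCost) ?_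
  filter_upwards [Ioo_mem_nhdsGT (Real.exp_pos (-1))] with ε hε
  have hl : 1 ≤ Real.log (1 / ε) := by
    rw [one_div, Real.log_inv]
    have := (Real.log_lt_iff_lt_exp hε.1).2 hε.2
    linarith
  have h1 := mul_le_mul_of_nonneg_left (log_div_sq_le (b := b) hc hε.1 hl) ha0
  have h2 : (I.Nouter ε : ℝ) ≤ a * ((|Real.log (b / c)| + 2) * Real.log (1 / ε)) + 1 := by
    refine (Nat.ceil_le_ceil h1 |> Nat.cast_le.2).trans (Nat.ceil_lt_add_one ?_).le
    positivity
  have h3 : ((max 1 (I.Nouter ε) : ℕ) : ℝ)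
      ≤ (a * (|Real.log (b / c)| + 2) + 2) * Real.log (1 / ε) := by
    have h4 : 0 ≤ a * ((|Real.log (b / c)| + 2) * Real.log (1 / ε)) := by positivity
    rw [Nat.cast_max, Nat.cast_one]
    refine max_le ?_ ?_ <;> nlinarith
  rw [Real.norm_of_nonneg (Nat.cast_nonneg _), Real.norm_of_nonneg (by linarith), Nbar,
    Nat.cast_mul]
  change _ * ((I.roundCost : ℕ) : ℝ) ≤ _
  rw [mul_right_comm]
  exact mul_le_mul_of_nonneg_right h3 (Nat.cast_nonneg _)

end Input

end Minimax

theorem mainTheorem1 {n m : ℕ} (I : Minimax.Input n m)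
    (hp : Minimax.ProperClosedConvex I.p) (hq : Minimax.ProperClosedConvex I.q)
    (hpc : IsCompact (Minimax.dom I.p)) (hqc : IsCompact (Minimax.dom I.q))
    (hσx : 0 < I.σx) (hσy : 0 < I.σy) (hL : 0 < I.L) (hε : 0 < I.ε)
    -- the starting point of the algorithm
    (hz0 : ∃ u ∈ Minimax.dom I.p, I.z0 = -(I.σx • u)) (hy0 : I.y0 ∈ Minimax.dom I.q)
    -- convex sets, containing the domains, on whose product `h` is as it should be
    (U : Set (Minimax.Vec n)) (V : Set (Minimax.Vec m)) (hU : Convex ℝ U) (hV : Convex ℝ V)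
    (hpU : Minimax.dom I.p ⊆ U) (hqV : Minimax.dom I.q ⊆ V)
    (hconv : Minimax.StronglyConvexConcaveOn I.h I.σx I.σy U V)
    (hsmooth : Minimax.SmoothOn I.h I.L (Minimax.box U V))
    -- the gradient of `h` is only evaluated there (automatic if `U` and `V` are the whole spaces)
    (hquery : ∀ j, ∀ w ∈ (I.run j).2.grad, w ∈ Minimax.box U V) :
    -- the optimal solution exists and is unique
    ∃ (xs : Minimax.Vec n) (ys : Minimax.Vec m),
      I.IsOptimal xs ys ∧ (∀ x y, I.IsOptimal x y → x = xs ∧ y = ys) ∧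
      -- the algorithm halts after at most `max {1, K̄}` outer iterations
      ∃ (j K : ℕ) (x : Minimax.Vec n) (y : Minimax.Vec m),
        (I.run j).1 = Minimax.Config.done K x y ∧
        K ≤ max 1 (I.Kbar (I.theta0 xs ys)) ∧
        Minimax.IsStationary I.H I.ε x y ∧
        -- the oracle complexity
        (I.Hlow ≠ ⊥ →
          (I.run j).2.grad.length ≤ I.Nbar I.ε ∧
          (I.run j).2.proxP.length ≤ I.Nbar I.ε ∧
          (I.run j).2.proxQ.length ≤ I.Nbar I.ε ∧
          (fun ε : ℝ => (I.Nbar ε : ℝ)) =O[𝓝[>] 0] fun ε : ℝ => Real.log (1 / ε)) := by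
  have hI : I.Assumptions U V := ⟨hp, hq, hpc, hqc, hσx, hσy, hL, hε, hpU, hqV, hconv, hsmooth⟩
  obtain ⟨xs, ys, hs⟩ := hI.exists_isSaddle
  refine ⟨xs, ys, hs.isOptimal hI, fun x y ho => hs.eq_of_isOptimal hI ho, ?_⟩
  obtain ⟨j, K, x, y, hj, hK, hst, hlen⟩ := Minimax.Input.exists_done hI hquery hs hy0
  refine ⟨j, K, x, y, hj, hK, hst, fun hlow => ?_⟩
  obtain ⟨u, hu, hz⟩ := hz0
  have h0 : 0 ≤ I.theta0 xs ys :=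
    Minimax.Input.theta_nonneg (s := ⟨I.z0, I.y0, I.z0, I.y0⟩) hI hs hy0
  have hKN : K ≤ max 1 (I.Nouter I.ε) :=
    hK.trans (max_le_max le_rfl
      (Minimax.Input.Kbar_le_Nouter hI h0 (hs.theta0_le hI hu hz hy0 hlow)))
  have hN : K * I.roundCost ≤ I.Nbar I.ε := Nat.mul_le_mul_right _ hKN
  obtain ⟨h1, h2, h3⟩ := hlen
  simp only [List.length_nil, zero_add] at h1 h2 h3
  exact ⟨h1.trans hN, h2.trans hN, h3.trans hN, Minimax.Input.Nbar_isBigO hI⟩
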